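/- Let $\mathbb{T}^1=\mathbb{R}/2\pi\mathbb{Z}$. Let $\mathcal{S}(\mathbb{T}^1\times\mathbb{R})$ be the space of all smooth functions $f:\mathbb{T}^1\times\mathbb{R}\to\mathbb{C}$ such that $\|f\|_{\alpha,\beta,\gamma}:=\sup_{(t,x)\in\mathbb{T}^1\times\mathbb{R}}|x^\gamma\partial_t^\alpha\partial_x^\beta f(t,x)|<\infty$ for all $\alpha,\beta,\gamma\in\mathbb{N}_0$, and put $p_N(f):=\sum_{\alpha+\beta+\gamma\le N}\|f\|_{\alpha,\beta,\gamma}$. Let $\mathcal{S}'(\mathbb{T}^1\times\mathbb{R})$ be the space of all linear functionals $u:\mathcal{S}(\mathbb{T}^1\times\mathbb{R})\to\mathbb{C}$ for which there are $N\in\mathbb{N}_0$ and $C>0$ with $|\langle u,f\rangle|\le C\,p_N(f)$ for all $f$. A function $g\in\mathcal{S}(\mathbb{T}^1\times\mathbb{R})$ is identified with the functional $f\mapsto\int_{\mathbb{T}^1\times\mathbb{R}}g(t,x)f(t,x)\,dt\,dx$, and the derivatives of $u\in\mathcal{S}'(\mathbb{T}^1\times\mathbb{R})$ are defined by $\langle\partial_t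 u,f\rangle=-\langle u,\partial_t f\rangle$ and $\langle\partial_x u,f\rangle=-\langle u,\partial_x f\rangle$. A linear operator $L$ on $\mathcal{S}'(\mathbb{T}^1\times\mathbb{R})$ is called Schwartz globally hypoelliptic if, for every $u\in\mathcal{S}'(\mathbb{T}^1\times\mathbb{R})$, $Lu\in\mathcal{S}(\mathbb{T}^1\times\mathbb{R})$ implies $u\in\mathcal{S}(\mathbb{T}^1\times\mathbb{R})$. Let $c_1,c_2,c_3\in\mathbb{C}$ with $c_1\neq0$ or $c_2\neq0$, and let $L=c_1\partial_t+c_2\partial_x+c_3$, acting on $\mathcal{S}'(\mathbb{T}^1\times\mathbb{R})$. Then $L$ is Schwartz globally hypoelliptic if and only if $$\{(k,\xi)\in\mathbb{Z}\times\mathbb{R}\;:\;c_1k+c_2\xi-ic_3=0\}=\emptyset.$$ -/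

import Mathlib

open scoped ContDiff Real

noncomputable section

namespace TorusLine

/-- The cylinder `𝕋¹ × ℝ`, where `𝕋¹ = ℝ / 2πℤ`. -/
abbrev Cyl : Type := AddCircle (2 * π) × ℝ

instance instFactTwoPiPos : Fact (0 < 2 * π) := ⟨Real.two_pi_pos⟩

/-- The pull-back of a function on `𝕋¹ × ℝ` to `ℝ × ℝ` (it is `2π`-periodic in the first
variable). -/
def lift (f : Cyl → ℂ) (p : ℝ × ℝ) : ℂ := f ((p.1 : AddCircle (2 * π)), p.2)

/-- The partial derivative `∂ₜ f` on the torus variable. -/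
def partialT (f : Cyl → ℂ) (p : Cyl) : ℂ :=
  deriv (fun s : ℝ => f (p.1 + (s : AddCircle (2 * π)), p.2)) 0

/-- The partial derivative `∂ₓ f` on the real variable. -/
def partialX (f : Cyl → ℂ) (p : Cyl) : ℂ :=
  deriv (fun s : ℝ => f (p.1, p.2 + s)) 0

lemma lift_injective : Function.Injective lift := by
  intro f g h
  funext ⟨t, x⟩
  induction t using QuotientAddGroup.induction_on with
  | H a => exact congrFun h (a, x)

lemma lift_partialT {f : Cyl → ℂ} (hf : ContDiff ℝ ∞ (lift f)) :
    lift (partialT f) = fun p => fderiv ℝ (lift f) p (1, 0) := by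
  funext p
  have h1 : HasFDerivAt (lift f) (fderiv ℝ (lift f) p) (p.1 + (0 : ℝ), p.2) := by
    simpa using ((hf.differentiable (by simp)) p).hasFDerivAt
  have h2 : HasDerivAt (fun s : ℝ => (p.1 + s, p.2)) ((1 : ℝ), (0 : ℝ)) 0 :=
    ((hasDerivAt_id (0 : ℝ)).const_add p.1).prodMk (hasDerivAt_const (0 : ℝ) p.2)
  have h3 := (h1.comp_hasDerivAt (0 : ℝ) h2).deriv
  rw [← h3]
  simp only [lift, partialT, Function.comp_def, AddCircle.coe_add]

lemma lift_partialX {f : Cyl → ℂ} (hf : ContDiff ℝ ∞ (lift f)) :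
    lift (partialX f) = fun p => fderiv ℝ (lift f) p (0, 1) := by
  funext p
  have h1 : HasFDerivAt (lift f) (fderiv ℝ (lift f) p) (p.1, p.2 + (0 : ℝ)) := by
    simpa using ((hf.differentiable (by simp)) p).hasFDerivAt
  have h2 : HasDerivAt (fun s : ℝ => (p.1, p.2 + s)) ((0 : ℝ), (1 : ℝ)) 0 :=
    (hasDerivAt_const (0 : ℝ) p.1).prodMk ((hasDerivAt_id (0 : ℝ)).const_add p.2)
  have h3 := (h1.comp_hasDerivAt (0 : ℝ) h2).deriv
  rw [← h3]
  simp only [lift, partialX, Function.comp_def]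

/-- The space `C^∞(𝕋¹ × ℝ)` of smooth complex-valued functions: those whose pull-back to
`ℝ × ℝ` is smooth. -/
def smoothSubmodule : Submodule ℂ (Cyl → ℂ) where
  carrier := {f | ContDiff ℝ ∞ (lift f)}
  add_mem' {f g} hf hg := by
    have hf' : ContDiff ℝ ∞ (lift f) := hf
    have hg' : ContDiff ℝ ∞ (lift g) := hg
    exact hf'.add hg'
  zero_mem' := by
    change ContDiff ℝ ∞ (fun _ : ℝ × ℝ => (0 : ℂ))
    exact contDiff_const
  smul_mem' c f hf := by
    have hf' : ContDiff ℝ ∞ (lift f) := hf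
    exact hf'.const_smul c

/-- `C^∞(𝕋¹ × ℝ)` as a vector space. -/
abbrev Smooth : Type := smoothSubmodule

lemma Smooth.contDiff (f : Smooth) : ContDiff ℝ ∞ (lift f) := f.2

lemma Smooth.differentiable (f : Smooth) : Differentiable ℝ (lift f) :=
  f.contDiff.differentiable (by simp)

lemma lift_add (f g : Cyl → ℂ) : lift (f + g) = lift f + lift g := rfl

lemma lift_smul (c : ℂ) (f : Cyl → ℂ) : lift (c • f) = c • lift f := rfl

/-- `∂ₜ` as a linear operator on `C^∞(𝕋¹ × ℝ)`. -/
def Smooth.dT : Module.End ℂ Smooth where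
  toFun f := ⟨partialT f, by
    change ContDiff ℝ ∞ (lift (partialT f))
    rw [lift_partialT f.contDiff]
    exact (f.contDiff.fderiv_right (m := ∞) (by simp)).clm_apply contDiff_const⟩
  map_add' f g := by
    apply Subtype.ext
    apply lift_injective
    have h := lift_partialT (f + g).contDiff
    simp only [Submodule.coe_add, lift_add] at h ⊢
    rw [h, lift_partialT f.contDiff, lift_partialT g.contDiff]
    funext p
    rw [fderiv_add (f.differentiable p) (g.differentiable p)]
    rfl
  map_smul' c f := by
    apply Subtype.ext
    apply lift_injective
    have h := lift_partialT (c • f).contDiff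
    simp only [Submodule.coe_smul, lift_smul, RingHom.id_apply] at h ⊢
    rw [h, lift_partialT f.contDiff]
    funext p
    rw [fderiv_const_smul (f.differentiable p)]
    rfl

/-- `∂ₓ` as a linear operator on `C^∞(𝕋¹ × ℝ)`. -/
def Smooth.dX : Module.End ℂ Smooth where
  toFun f := ⟨partialX f, by
    change ContDiff ℝ ∞ (lift (partialX f))
    rw [lift_partialX f.contDiff]
    exact (f.contDiff.fderiv_right (m := ∞) (by simp)).clm_apply contDiff_const⟩
  map_add' f g := by
    apply Subtype.ext
    apply lift_injective
    have h := lift_partialX (f + g).contDiff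
    simp only [Submodule.coe_add, lift_add] at h ⊢
    rw [h, lift_partialX f.contDiff, lift_partialX g.contDiff]
    funext p
    rw [fderiv_add (f.differentiable p) (g.differentiable p)]
    rfl
  map_smul' c f := by
    apply Subtype.ext
    apply lift_injective
    have h := lift_partialX (c • f).contDiff
    simp only [Submodule.coe_smul, lift_smul, RingHom.id_apply] at h ⊢
    rw [h, lift_partialX f.contDiff]
    funext p
    rw [fderiv_const_smul (f.differentiable p)]
    rfl

lemma Smooth.lift_dT (f : Smooth) :
    lift (Smooth.dT f) = fun p => fderiv ℝ (lift f) p (1, 0) := lift_partialT f.contDiff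

lemma Smooth.lift_dX (f : Smooth) :
    lift (Smooth.dX f) = fun p => fderiv ℝ (lift f) p (0, 1) := lift_partialX f.contDiff

lemma Smooth.commute_dX_dT : Commute Smooth.dX Smooth.dT := by
  refine LinearMap.ext fun f => ?_
  apply Subtype.ext
  apply lift_injective
  change lift (Smooth.dX (Smooth.dT f)) = lift (Smooth.dT (Smooth.dX f))
  have hd : Differentiable ℝ (fderiv ℝ (lift f)) :=
    (f.contDiff.fderiv_right (m := ∞) (by simp)).differentiable (by simp)
  rw [Smooth.lift_dX, Smooth.lift_dT (Smooth.dX f), Smooth.lift_dX, Smooth.lift_dT]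
  funext p
  have hs : IsSymmSndFDerivAt ℝ (lift f) p :=
    f.contDiff.contDiffAt.isSymmSndFDerivAt (by
      simpa using (WithTop.coe_le_coe.2 le_top : ((2 : ℕ∞) : WithTop ℕ∞) ≤ ((⊤ : ℕ∞) : WithTop ℕ∞)))
  rw [fderiv_clm_apply (hd p) (by fun_prop), fderiv_clm_apply (hd p) (by fun_prop)]
  simpa using hs.eq (0, 1) (1, 0)

/-- `∂ₜ^a ∂ₓ^b f` for `f ∈ C^∞(𝕋¹ × ℝ)`. -/
def Smooth.iterD (a b : ℕ) : Module.End ℂ Smooth := Smooth.dT ^ a * Smooth.dX ^ b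

lemma Smooth.iterD_dT (a b : ℕ) (f : Smooth) :
    Smooth.iterD a b (Smooth.dT f) = Smooth.iterD (a + 1) b f := by
  change (Smooth.dT ^ a * Smooth.dX ^ b * Smooth.dT) f = _
  rw [mul_assoc, (Smooth.commute_dX_dT.pow_left b).eq, ← mul_assoc, ← pow_succ]
  rfl

lemma Smooth.iterD_dX (a b : ℕ) (f : Smooth) :
    Smooth.iterD a b (Smooth.dX f) = Smooth.iterD a (b + 1) f := by
  change (Smooth.dT ^ a * Smooth.dX ^ b * Smooth.dX) f = _
  rw [mul_assoc, ← pow_succ]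
  rfl

/-- The function `|x^c ∂ₜ^a ∂ₓ^b f(t, x)|`. -/
def weighted (a b c : ℕ) (f : Smooth) (p : Cyl) : ℝ :=
  |p.2| ^ c * ‖(Smooth.iterD a b f : Cyl → ℂ) p‖

lemma weighted_nonneg (a b c : ℕ) (f : Smooth) (p : Cyl) : 0 ≤ weighted a b c f p := by
  unfold weighted; positivity

lemma weighted_add_le (a b c : ℕ) (f g : Smooth) (p : Cyl) :
    weighted a b c (f + g) p ≤ weighted a b c f p + weighted a b c g p := by
  simp only [weighted, map_add, Submodule.coe_add, Pi.add_apply, ← mul_add]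
  gcongr
  exact norm_add_le _ _

lemma weighted_smul (a b c : ℕ) (z : ℂ) (f : Smooth) (p : Cyl) :
    weighted a b c (z • f) p = ‖z‖ * weighted a b c f p := by
  simp only [weighted, map_smul, Submodule.coe_smul, Pi.smul_apply, norm_smul]
  ring

/-- The Schwartz space `𝓢(𝕋¹ × ℝ)`: the smooth `f` with `sup |x^c ∂ₜ^a ∂ₓ^b f| < ∞` for all
`a, b, c`. -/
def schwartzSubmodule : Submodule ℂ Smooth where
  carrier := {f | ∀ a b c : ℕ, BddAbove (Set.range (weighted a b c f))}
  add_mem' {f g} hf hg a b c := by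
    obtain ⟨C, hC⟩ := hf a b c
    obtain ⟨D, hD⟩ := hg a b c
    refine ⟨C + D, ?_⟩
    rintro _ ⟨p, rfl⟩
    exact (weighted_add_le a b c f g p).trans (add_le_add (hC ⟨p, rfl⟩) (hD ⟨p, rfl⟩))
  zero_mem' a b c := by
    refine ⟨0, ?_⟩
    rintro _ ⟨p, rfl⟩
    simp [weighted]
  smul_mem' z f hf a b c := by
    obtain ⟨C, hC⟩ := hf a b c
    refine ⟨‖z‖ * C, ?_⟩
    rintro _ ⟨p, rfl⟩
    rw [weighted_smul]
    exact mul_le_mul_of_nonneg_left (hC ⟨p, rfl⟩) (norm_nonneg z)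

/-- `𝓢(𝕋¹ × ℝ)` as a vector space. -/
abbrev Schwartz : Type := schwartzSubmodule

instance : CoeFun Schwartz (fun _ => Cyl → ℂ) := ⟨fun f => f.1.1⟩

/-- The seminorm `‖f‖_{a,b,c} = sup |x^c ∂ₜ^a ∂ₓ^b f|`. -/
def Schwartz.seminorm (a b c : ℕ) (f : Schwartz) : ℝ := ⨆ p : Cyl, weighted a b c f.1 p

lemma Schwartz.seminorm_nonneg (a b c : ℕ) (f : Schwartz) : 0 ≤ f.seminorm a b c :=
  Real.iSup_nonneg (weighted_nonneg a b c f.1)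

lemma Schwartz.weighted_le (a b c : ℕ) (f : Schwartz) (p : Cyl) :
    weighted a b c f.1 p ≤ f.seminorm a b c := le_ciSup (f.2 a b c) p

/-- The triples `(a, b, c)` with `a + b + c ≤ N`. -/
def triples (N : ℕ) : Finset (ℕ × ℕ × ℕ) :=
  (Finset.range (N + 1) ×ˢ Finset.range (N + 1) ×ˢ Finset.range (N + 1)).filter
    fun i => i.1 + i.2.1 + i.2.2 ≤ N

lemma mem_triples {N : ℕ} {i : ℕ × ℕ × ℕ} : i ∈ triples N ↔ i.1 + i.2.1 + i.2.2 ≤ N := by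
  simp only [triples, Finset.mem_filter, Finset.mem_product, Finset.mem_range]
  omega

/-- The norm `p_N(f)`, the sum of `‖f‖_{a,b,c}` over all `a + b + c ≤ N`. -/
def Schwartz.pNorm (N : ℕ) (f : Schwartz) : ℝ :=
  ∑ i ∈ triples N, f.seminorm i.1 i.2.1 i.2.2

/-- `∂ₜ : 𝓢(𝕋¹ × ℝ) → 𝓢(𝕋¹ × ℝ)`. -/
def Schwartz.dT : Module.End ℂ Schwartz :=
  Smooth.dT.restrict (p := schwartzSubmodule) (q := schwartzSubmodule) fun f hf a b c => by
    have h : weighted a b c (Smooth.dT f) = weighted (a + 1) b c f := by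
      funext p; simp only [weighted, Smooth.iterD_dT]
    rw [h]
    exact hf (a + 1) b c

/-- `∂ₓ : 𝓢(𝕋¹ × ℝ) → 𝓢(𝕋¹ × ℝ)`. -/
def Schwartz.dX : Module.End ℂ Schwartz :=
  Smooth.dX.restrict (p := schwartzSubmodule) (q := schwartzSubmodule) fun f hf a b c => by
    have h : weighted a b c (Smooth.dX f) = weighted a (b + 1) c f := by
      funext p; simp only [weighted, Smooth.iterD_dX]
    rw [h]
    exact hf a (b + 1) c

lemma Schwartz.seminorm_dT (a b c : ℕ) (f : Schwartz) :
    (Schwartz.dT f).seminorm a b c = f.seminorm (a + 1) b c := by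
  have h : weighted a b c (Smooth.dT f.1) = weighted (a + 1) b c f.1 := by
    funext p; simp only [weighted, Smooth.iterD_dT]
  exact congrArg iSup h

lemma Schwartz.seminorm_dX (a b c : ℕ) (f : Schwartz) :
    (Schwartz.dX f).seminorm a b c = f.seminorm a (b + 1) c := by
  have h : weighted a b c (Smooth.dX f.1) = weighted a (b + 1) c f.1 := by
    funext p; simp only [weighted, Smooth.iterD_dX]
  exact congrArg iSup h

lemma Schwartz.seminorm_le_pNorm {a b c N : ℕ} (h : a + b + c ≤ N) (f : Schwartz) :
    f.seminorm a b c ≤ f.pNorm N :=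
  Finset.single_le_sum (f := fun i : ℕ × ℕ × ℕ => f.seminorm i.1 i.2.1 i.2.2)
    (fun _ _ => f.seminorm_nonneg _ _ _) (mem_triples (i := (a, b, c)).2 h)

lemma Schwartz.pNorm_nonneg (N : ℕ) (f : Schwartz) : 0 ≤ f.pNorm N :=
  Finset.sum_nonneg fun _ _ => f.seminorm_nonneg _ _ _

lemma Schwartz.pNorm_mono {M N : ℕ} (h : M ≤ N) (f : Schwartz) : f.pNorm M ≤ f.pNorm N :=
  Finset.sum_le_sum_of_subset_of_nonneg
    (fun _ hi => mem_triples.2 ((mem_triples.1 hi).trans h))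
    (fun _ _ _ => f.seminorm_nonneg _ _ _)

lemma Schwartz.pNorm_dT_le (N : ℕ) (f : Schwartz) :
    (Schwartz.dT f).pNorm N ≤ (triples N).card * f.pNorm (N + 1) := by
  rw [← nsmul_eq_mul]
  refine Finset.sum_le_card_nsmul _ _ _ fun i hi => ?_
  rw [Schwartz.seminorm_dT]
  exact Schwartz.seminorm_le_pNorm (by have := mem_triples.1 hi; omega) f

lemma Schwartz.pNorm_dX_le (N : ℕ) (f : Schwartz) :
    (Schwartz.dX f).pNorm N ≤ (triples N).card * f.pNorm (N + 1) := by
  rw [← nsmul_eq_mul]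
  refine Finset.sum_le_card_nsmul _ _ _ fun i hi => ?_
  rw [Schwartz.seminorm_dX]
  exact Schwartz.seminorm_le_pNorm (by have := mem_triples.1 hi; omega) f

/-- The space `𝓢'(𝕋¹ × ℝ)`: the linear functionals `u` on `𝓢(𝕋¹ × ℝ)` for which there are
`N` and `C` with `|⟨u, f⟩| ≤ C p_N(f)` for all `f`. -/
def temperedSubmodule : Submodule ℂ (Schwartz →ₗ[ℂ] ℂ) where
  carrier := {u | ∃ (N : ℕ) (C : ℝ), ∀ f : Schwartz, ‖u f‖ ≤ C * f.pNorm N}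
  add_mem' {u v} hu hv := by
    obtain ⟨N, C, hC⟩ := hu
    obtain ⟨M, D, hD⟩ := hv
    refine ⟨max N M, |C| + |D|, fun f => ?_⟩
    have h1 : C * f.pNorm N ≤ |C| * f.pNorm (max N M) :=
      mul_le_mul (le_abs_self C) (f.pNorm_mono (le_max_left _ _)) (f.pNorm_nonneg _)
        (abs_nonneg C)
    have h2 : D * f.pNorm M ≤ |D| * f.pNorm (max N M) :=
      mul_le_mul (le_abs_self D) (f.pNorm_mono (le_max_right _ _)) (f.pNorm_nonneg _)
        (abs_nonneg D)
    have h3 : ‖(u + v) f‖ ≤ ‖u f‖ + ‖v f‖ := norm_add_le _ _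
    linarith [hC f, hD f]
  zero_mem' := ⟨0, 0, fun f => by simp⟩
  smul_mem' z u hu := by
    obtain ⟨N, C, hC⟩ := hu
    refine ⟨N, ‖z‖ * C, fun f => ?_⟩
    rw [LinearMap.smul_apply, norm_smul, mul_assoc]
    exact mul_le_mul_of_nonneg_left (hC f) (norm_nonneg z)

/-- `𝓢'(𝕋¹ × ℝ)` as a vector space. -/
abbrev Tempered : Type := temperedSubmodule

/-- The transposition of an operator `A` on `𝓢(𝕋¹ × ℝ)` with `p_N(A f) ≤ C_N p_{N+1}(f)`:
`⟨u, f⟩ ↦ -⟨u, A f⟩`. -/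
def Tempered.negTranspose (A : Module.End ℂ Schwartz)
    (hA : ∀ (N : ℕ) (f : Schwartz), (A f).pNorm N ≤ (triples N).card * f.pNorm (N + 1)) :
    Module.End ℂ Tempered where
  toFun u := ⟨-(u.1.comp A), by
    obtain ⟨N, C, hC⟩ := u.2
    refine ⟨N + 1, |C| * (triples N).card, fun f => ?_⟩
    rw [LinearMap.neg_apply, norm_neg, LinearMap.comp_apply, mul_assoc]
    exact (hC (A f)).trans
      (mul_le_mul (le_abs_self C) (hA N f) ((A f).pNorm_nonneg N) (abs_nonneg C))⟩
  map_add' u v := by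
    apply Subtype.ext
    refine LinearMap.ext fun f => ?_
    exact neg_add (u.1 (A f)) (v.1 (A f))
  map_smul' z u := by
    apply Subtype.ext
    refine LinearMap.ext fun f => ?_
    exact (mul_neg z (u.1 (A f))).symm

/-- `∂ₜ` on `𝓢'(𝕋¹ × ℝ)`: `⟨∂ₜ u, f⟩ = -⟨u, ∂ₜ f⟩`. -/
def Tempered.dT : Module.End ℂ Tempered :=
  Tempered.negTranspose Schwartz.dT Schwartz.pNorm_dT_le

/-- `∂ₓ` on `𝓢'(𝕋¹ × ℝ)`: `⟨∂ₓ u, f⟩ = -⟨u, ∂ₓ f⟩`. -/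
def Tempered.dX : Module.End ℂ Tempered :=
  Tempered.negTranspose Schwartz.dX Schwartz.pNorm_dX_le

lemma Tempered.dT_apply (u : Tempered) (f : Schwartz) :
    (Tempered.dT u).1 f = -u.1 (Schwartz.dT f) := rfl

lemma Tempered.dX_apply (u : Tempered) (f : Schwartz) :
    (Tempered.dX u).1 f = -u.1 (Schwartz.dX f) := rfl

lemma Smooth.continuous (f : Smooth) : Continuous (f : Cyl → ℂ) := by
  have h1 : Continuous (lift f) := f.contDiff.continuous
  have hq : IsOpenQuotientMap (fun a : ℝ => (a : AddCircle (2 * π))) :=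
    QuotientAddGroup.isOpenQuotientMap_mk
  have h2 := hq.prodMap (IsOpenQuotientMap.id (X := ℝ))
  exact h2.isQuotientMap.continuous_iff.2 h1

lemma Schwartz.norm_le (f : Schwartz) (p : Cyl) : ‖f p‖ ≤ f.seminorm 0 0 0 := by
  simpa [weighted, Smooth.iterD] using f.weighted_le 0 0 0 p

lemma Schwartz.integrable (f : Schwartz) : MeasureTheory.Integrable f := by
  have hb : ∀ p : Cyl, ‖f p‖ ≤ (f.seminorm 0 0 0 + f.seminorm 0 0 2) * (1 + p.2 ^ 2)⁻¹ := by
    intro p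
    have h0 := f.norm_le p
    have h2 := f.weighted_le 0 0 2 p
    simp only [weighted, Smooth.iterD, pow_zero, mul_one, Module.End.one_apply, sq_abs] at h2
    rw [← div_eq_mul_inv, le_div_iff₀ (by positivity)]
    linarith
  have hi : MeasureTheory.Integrable
      (fun p : Cyl => (f.seminorm 0 0 0 + f.seminorm 0 0 2) * (1 + p.2 ^ 2)⁻¹) :=
    (integrable_inv_one_add_sq.comp_snd (MeasureTheory.volume : MeasureTheory.Measure (AddCircle (2 * π)))).const_mul _
  exact hi.mono' f.1.continuous.aestronglyMeasurable (Filter.Eventually.of_forall hb)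

lemma Schwartz.integrable_mul (g f : Schwartz) :
    MeasureTheory.Integrable (fun p => g p * f p) :=
  g.integrable.mul_bdd f.1.continuous.aestronglyMeasurable
    (Filter.Eventually.of_forall f.norm_le)

/-- The embedding `𝓢(𝕋¹ × ℝ) ⊂ 𝓢'(𝕋¹ × ℝ)`: the function `g` acts by
`f ↦ ∫ g(t, x) f(t, x) dt dx`, where `dt` has total mass `2π`. -/
def Schwartz.toTempered (g : Schwartz) : Tempered :=
  ⟨{ toFun := fun f => ∫ p : Cyl, g p * f p
     map_add' := fun f₁ f₂ => by
       rw [← MeasureTheory.integral_add (g.integrable_mul f₁) (g.integrable_mul f₂)]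
       congr 1
       funext p
       exact mul_add _ _ _
     map_smul' := fun z f => by
       rw [RingHom.id_apply, ← MeasureTheory.integral_smul]
       congr 1
       funext p
       exact mul_left_comm _ _ _ },
   ⟨0, ∫ p : Cyl, ‖g p‖, fun f => by
     have h : ∀ p : Cyl, ‖g p * f p‖ ≤ ‖g p‖ * f.pNorm 0 := fun p => by
       rw [norm_mul]
       exact mul_le_mul_of_nonneg_left
         ((f.norm_le p).trans (Schwartz.seminorm_le_pNorm le_rfl f)) (norm_nonneg _)
     have h1 := MeasureTheory.norm_integral_le_of_norm_le
       (g.integrable.norm.mul_const (f.pNorm 0)) (Filter.Eventually.of_forall h)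
     rwa [MeasureTheory.integral_mul_const] at h1⟩⟩

/-- An operator `L` on `𝓢'(𝕋¹ × ℝ)` is Schwartz globally hypoelliptic if `L u ∈ 𝓢(𝕋¹ × ℝ)`
implies `u ∈ 𝓢(𝕋¹ × ℝ)`, for every `u ∈ 𝓢'(𝕋¹ × ℝ)`. -/
def IsSchwartzGloballyHypoelliptic (L : Module.End ℂ Tempered) : Prop :=
  ∀ u : Tempered, (∃ f : Schwartz, L u = f.toTempered) → ∃ g : Schwartz, u = g.toTempered

/-- The operator `c₁ ∂ₜ + c₂ ∂ₓ + c₃` on `𝓢'(𝕋¹ × ℝ)`. -/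
def firstOrderOp (c₁ c₂ c₃ : ℂ) : Module.End ℂ Tempered :=
  c₁ • Tempered.dT + c₂ • Tempered.dX + c₃ • LinearMap.id

end TorusLine

end

noncomputable section

namespace TorusLine

open MeasureTheory

/-! Necessity: a zero `(k, ξ)` of the symbol makes `L` kill the character `exp (i (k t + ξ x))`,
which has modulus one and so is tempered but not Schwartz (`character_toTempered_ne`).

Sufficiency is a duality argument. If the symbol has no zeros, neither has that of the transpose `Lᵗ
= -c₁ ∂ₜ - c₂ ∂ₓ + c₃`, and both map `𝓢` onto `𝓢` (`schwartzOp_surjective`). Write `L u = L g` with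
`g ∈ 𝓢` and a test function as `φ = Lᵗ ψ`; then `⟨u, φ⟩ = ⟨L u, ψ⟩ = ⟨L g, ψ⟩ = ⟨g, φ⟩`, so `u = g`.

Surjectivity comes from explicit inverses that average translates (`Kernel`); such averages preserve
`𝓢` and commute with `L`, so a left inverse is also a right inverse. If `c₂ = 0`, one integrates
`exp (-q s)` over a period of the circle. If `c₂ ≠ 0`, division by `c₂` and projection to the `k`-th
Fourier mode in `t` leave the ODE operator `∂ₓ + z_k`, with `z_k = i a k + q`. Absence of zeros says
`Re z_k ≠ 0` for all `k`; since `Re z_k` is affine in `k`, it is bounded away from zero, so the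
decaying fundamental solutions are bounded by `exp (-δ |s|)` uniformly in `k`. The factor `(1 +
k²)⁻¹` makes their sum over `k` converge and is compensated by `1 - ∂ₜ²`. -/

lemma Smooth.hasFDerivAt_translate (f : Smooth) (y : Cyl) (r : ℝ × ℝ) :
    HasFDerivAt (fun r : ℝ × ℝ => (f : Cyl → ℂ) (((r.1 : AddCircle (2 * π)), r.2) - y))
      ((ContinuousLinearMap.fst ℝ ℝ ℝ).smulRight
          ((Smooth.dT f : Cyl → ℂ) (((r.1 : AddCircle (2 * π)), r.2) - y)) +
        (ContinuousLinearMap.snd ℝ ℝ ℝ).smulRight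
          ((Smooth.dX f : Cyl → ℂ) (((r.1 : AddCircle (2 * π)), r.2) - y))) r := by
  obtain ⟨y₁, b⟩ := y
  induction y₁ using QuotientAddGroup.induction_on with
  | H a =>
    have h1 : HasFDerivAt (lift f) (fderiv ℝ (lift f) (r - (a, b))) (r - (a, b)) :=
      (f.differentiable _).hasFDerivAt
    have h2 := h1.comp r ((hasFDerivAt_id r).sub_const (a, b))
    refine h2.congr_fderiv ?_
    have hT := congrFun f.lift_dT (r - (a, b))
    have hX := congrFun f.lift_dX (r - (a, b))
    have eT : (Smooth.dT f : Cyl → ℂ) (((r.1 : AddCircle (2 * π)), r.2) -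
        ((a : AddCircle (2 * π)), b)) = fderiv ℝ (lift f) (r - (a, b)) (1, 0) := hT
    have eX : (Smooth.dX f : Cyl → ℂ) (((r.1 : AddCircle (2 * π)), r.2) -
        ((a : AddCircle (2 * π)), b)) = fderiv ℝ (lift f) (r - (a, b)) (0, 1) := hX
    erw [eT, eX]
    ext <;> simp

/-! ### Averages of translates preserve the Schwartz space -/

/-- A weighted family of translations of `𝕋¹ × ℝ`, with all moments finite. -/
structure Kernel {S : Type*} [MeasurableSpace S] (μ : Measure S) where
  /-- The weight of a translation. -/
  weight : S → ℂ
  /-- The vector of translation. -/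
  shift : S → Cyl
  measurable_shift : Measurable shift
  integrable_moment : ∀ c : ℕ, Integrable (fun s => ((|(shift s).2| ^ c : ℝ) : ℂ) * weight s) μ

namespace Kernel

variable {S : Type*} [MeasurableSpace S] {μ : Measure S} (K : Kernel μ)

lemma integrable_weight : Integrable K.weight μ := by
  simpa using K.integrable_moment 0

/-- The weighted mean of the translates of a function. -/
def avg (f : Cyl → ℂ) (p : Cyl) : ℂ := ∫ s, K.weight s * f (p - K.shift s) ∂μ

lemma integrable_avg (f : Schwartz) (p : Cyl) :
    Integrable (fun s => K.weight s * f (p - K.shift s)) μ :=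
  K.integrable_weight.mul_bdd
    (f.1.continuous.measurable.comp (measurable_const.sub K.measurable_shift)).aestronglyMeasurable
    (Filter.Eventually.of_forall fun _ => f.norm_le _)

/-- Differentiation under the integral sign, dominated by the modulus of the weight times the sup
norms of the two partial derivatives. The derivative consists again of averages of Schwartz
functions, which drives the induction for smoothness. -/
lemma hasFDerivAt_lift_avg (f : Schwartz) (r : ℝ × ℝ) :
    HasFDerivAt (lift (K.avg f))
      ((ContinuousLinearMap.fst ℝ ℝ ℝ).smulRight (lift (K.avg (Schwartz.dT f)) r) +
        (ContinuousLinearMap.snd ℝ ℝ ℝ).smulRight (lift (K.avg (Schwartz.dX f)) r)) r := by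
  -- Written through `smulRightL`, the derivative is a continuous linear image of a scalar
  -- integrand, so it can be integrated by pulling this map out.
  let F' : ℝ × ℝ → S → (ℝ × ℝ →L[ℝ] ℂ) := fun r s =>
    ContinuousLinearMap.smulRightL ℝ (ℝ × ℝ) ℂ (ContinuousLinearMap.fst ℝ ℝ ℝ)
        (K.weight s * Schwartz.dT f (((r.1 : AddCircle (2 * π)), r.2) - K.shift s)) +
      ContinuousLinearMap.smulRightL ℝ (ℝ × ℝ) ℂ (ContinuousLinearMap.snd ℝ ℝ ℝ)
        (K.weight s * Schwartz.dX f (((r.1 : AddCircle (2 * π)), r.2) - K.shift s))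
  have hi (r : ℝ × ℝ) := K.integrable_avg (Schwartz.dT f) ((r.1 : AddCircle (2 * π)), r.2)
  have hj (r : ℝ × ℝ) := K.integrable_avg (Schwartz.dX f) ((r.1 : AddCircle (2 * π)), r.2)
  have hi' := (ContinuousLinearMap.smulRightL ℝ (ℝ × ℝ) ℂ
    (ContinuousLinearMap.fst ℝ ℝ ℝ)).integrable_comp (hi r)
  have hj' := (ContinuousLinearMap.smulRightL ℝ (ℝ × ℝ) ℂ
    (ContinuousLinearMap.snd ℝ ℝ ℝ)).integrable_comp (hj r)
  have key := hasFDerivAt_integral_of_dominated_of_fderiv_le (𝕜 := ℝ) (μ := μ)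
    (F := fun (r : ℝ × ℝ) s => K.weight s * f (((r.1 : AddCircle (2 * π)), r.2) - K.shift s))
    (F' := F') (x₀ := r) (s := Set.univ)
    (bound := fun s => ‖K.weight s‖ *
      ((Schwartz.dT f).seminorm 0 0 0 + (Schwartz.dX f).seminorm 0 0 0))
    Filter.univ_mem
    (Filter.Eventually.of_forall fun r => (K.integrable_avg f _).aestronglyMeasurable)
    (K.integrable_avg f _) (hi'.add hj').aestronglyMeasurable
    (Filter.Eventually.of_forall fun s r _ => ?_)
    (K.integrable_weight.norm.mul_const _)
    (Filter.Eventually.of_forall fun s r _ => ?_)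
  · refine key.congr_fderiv ?_
    have e1 := (ContinuousLinearMap.smulRightL ℝ (ℝ × ℝ) ℂ
      (ContinuousLinearMap.fst ℝ ℝ ℝ)).integral_comp_comm (hi r)
    have e2 := (ContinuousLinearMap.smulRightL ℝ (ℝ × ℝ) ℂ
      (ContinuousLinearMap.snd ℝ ℝ ℝ)).integral_comp_comm (hj r)
    have e3 := integral_add hi' hj'
    rw [e1, e2] at e3
    exact e3
  · have h1 := (Schwartz.dT f).norm_le (((r.1 : AddCircle (2 * π)), r.2) - K.shift s)
    have h2 := (Schwartz.dX f).norm_le (((r.1 : AddCircle (2 * π)), r.2) - K.shift s)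
    refine (norm_add_le _ _).trans ?_
    rw [mul_add]
    refine add_le_add ?_ ?_
    · refine (ContinuousLinearMap.norm_smulRight_apply (ContinuousLinearMap.fst ℝ ℝ ℝ) _).trans_le ?_
      rw [norm_mul]
      refine (mul_le_of_le_one_left (by positivity)
        (ContinuousLinearMap.norm_fst_le ℝ ℝ ℝ)).trans ?_
      gcongr
    · refine (ContinuousLinearMap.norm_smulRight_apply (ContinuousLinearMap.snd ℝ ℝ ℝ) _).trans_le ?_
      rw [norm_mul]
      refine (mul_le_of_le_one_left (by positivity)
        (ContinuousLinearMap.norm_snd_le ℝ ℝ ℝ)).trans ?_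
      gcongr
  · have h := (f.1.hasFDerivAt_translate (K.shift s) r).const_mul (K.weight s)
    refine h.congr_fderiv ?_
    change _ = F' r s
    have eT : ((Schwartz.dT f).1 : Smooth) = Smooth.dT f.1 := rfl
    have eX : ((Schwartz.dX f).1 : Smooth) = Smooth.dX f.1 := rfl
    ext <;> simp [F', eT, eX]

lemma contDiff_lift_avg (n : ℕ) (f : Schwartz) : ContDiff ℝ n (lift (K.avg f)) := by
  induction n generalizing f with
  | zero =>
    refine contDiff_zero.2 (continuous_iff_continuousAt.2 fun r => ?_)
    exact (K.hasFDerivAt_lift_avg f r).continuousAt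
  | succ n ih =>
    refine contDiff_succ_iff_hasFDerivAt.2 ⟨_, ?_, K.hasFDerivAt_lift_avg f⟩
    exact (contDiff_const.smulRight (ih _)).add (contDiff_const.smulRight (ih _))

/-- The mean of the translates of a Schwartz function, as a smooth function. -/
def avgSmooth (f : Schwartz) : Smooth :=
  ⟨K.avg f, contDiff_infty.2 fun n => K.contDiff_lift_avg n f⟩

lemma dT_avgSmooth (f : Schwartz) : Smooth.dT (K.avgSmooth f) = K.avgSmooth (Schwartz.dT f) := by
  apply Subtype.ext
  apply lift_injective
  rw [Smooth.lift_dT]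
  funext r
  have h : fderiv ℝ (lift (K.avgSmooth f)) r = _ := (K.hasFDerivAt_lift_avg f r).fderiv
  rw [h]
  simp
  rfl

lemma dX_avgSmooth (f : Schwartz) : Smooth.dX (K.avgSmooth f) = K.avgSmooth (Schwartz.dX f) := by
  apply Subtype.ext
  apply lift_injective
  rw [Smooth.lift_dX]
  funext r
  have h : fderiv ℝ (lift (K.avgSmooth f)) r = _ := (K.hasFDerivAt_lift_avg f r).fderiv
  rw [h]
  simp
  rfl

lemma iterD_avgSmooth (a b : ℕ) (f : Schwartz) :
    Smooth.iterD a b (K.avgSmooth f) =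
      K.avgSmooth ((Schwartz.dT ^ a * Schwartz.dX ^ b) f) := by
  have hX : ∀ (b : ℕ) (f : Schwartz),
      (Smooth.dX ^ b) (K.avgSmooth f) = K.avgSmooth ((Schwartz.dX ^ b) f) := by
    intro b
    induction b with
    | zero => intro f; rfl
    | succ b ih =>
      intro f
      rw [pow_succ, pow_succ, Module.End.mul_apply, dX_avgSmooth, ih, Module.End.mul_apply]
  have hT : ∀ (a : ℕ) (f : Schwartz),
      (Smooth.dT ^ a) (K.avgSmooth f) = K.avgSmooth ((Schwartz.dT ^ a) f) := by
    intro a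
    induction a with
    | zero => intro f; rfl
    | succ b ih =>
      intro f
      rw [pow_succ, pow_succ, Module.End.mul_apply, dT_avgSmooth, ih, Module.End.mul_apply]
  rw [Smooth.iterD, Module.End.mul_apply, Module.End.mul_apply, hX, hT]

/-- The weight `|x|^c` is shared between the translated point and the shift; the second share is
paid for by the `c`-th moment of the kernel. -/
lemma bddAbove_avg (c : ℕ) (f : Schwartz) :
    BddAbove (Set.range fun p : Cyl => |p.2| ^ c * ‖K.avg f p‖) := by
  refine ⟨∫ s, 2 ^ (c - 1) * (‖K.weight s‖ * f.seminorm 0 0 c +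
    ‖((|(K.shift s).2| ^ c : ℝ) : ℂ) * K.weight s‖ * f.seminorm 0 0 0) ∂μ, ?_⟩
  rintro _ ⟨p, rfl⟩
  have h : |p.2| ^ c * ‖K.avg f p‖ =
      ‖∫ s, ((|p.2| ^ c : ℝ) : ℂ) * (K.weight s * f (p - K.shift s)) ∂μ‖ := by
    rw [integral_const_mul, norm_mul, Complex.norm_real, Real.norm_of_nonneg (by positivity)]
    rfl
  simp only [h]
  refine norm_integral_le_of_norm_le ?_ (Filter.Eventually.of_forall fun s => ?_)
  · exact ((K.integrable_weight.norm.mul_const _).add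
      ((K.integrable_moment c).norm.mul_const _)).const_mul _
  · have h0 := f.norm_le (p - K.shift s)
    have hc := f.weighted_le 0 0 c (p - K.shift s)
    simp only [weighted, Smooth.iterD, pow_zero, mul_one, Module.End.one_apply] at hc
    simp only [norm_mul, Complex.norm_real, Real.norm_of_nonneg (pow_nonneg (abs_nonneg _) c)]
    -- The subtraction `c - 1` is truncated: for `c = 0` the factor is `1` and the bound reads `1 ≤
    -- 2`.
    have h1 : |p.2| ^ c ≤ 2 ^ (c - 1) * (|(p - K.shift s).2| ^ c + |(K.shift s).2| ^ c) := by
      refine le_trans ?_ (add_pow_le (abs_nonneg _) (abs_nonneg _) c)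
      gcongr
      have := abs_add_le (p - K.shift s).2 (K.shift s).2
      simpa using this
    calc _ ≤ 2 ^ (c - 1) * (|(p - K.shift s).2| ^ c + |(K.shift s).2| ^ c) *
          (‖K.weight s‖ * ‖f (p - K.shift s)‖) := by gcongr
      _ = 2 ^ (c - 1) * (‖K.weight s‖ * (|(p - K.shift s).2| ^ c * ‖f (p - K.shift s)‖) +
          |(K.shift s).2| ^ c * ‖K.weight s‖ * ‖f (p - K.shift s)‖) := by ring
      _ ≤ _ := by gcongr

/-- The weighted mean of translations, as a linear operator on `𝓢(𝕋¹ × ℝ)`. -/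
def avgSchwartz : Module.End ℂ Schwartz where
  toFun f := ⟨K.avgSmooth f, fun a b c => by
    have h := K.bddAbove_avg c ((Schwartz.dT ^ a * Schwartz.dX ^ b) f)
    have e : weighted a b c (K.avgSmooth f) =
        fun p : Cyl => |p.2| ^ c * ‖K.avg ((Schwartz.dT ^ a * Schwartz.dX ^ b) f) p‖ := by
      funext p
      rw [weighted, iterD_avgSmooth]
      rfl
    rwa [e]⟩
  map_add' f g := by
    apply Subtype.ext
    apply Subtype.ext
    funext p
    refine Eq.trans ?_ (integral_add (K.integrable_avg f p) (K.integrable_avg g p))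
    exact integral_congr_ae (Filter.Eventually.of_forall fun s => mul_add _ _ _)
  map_smul' z f := by
    apply Subtype.ext
    apply Subtype.ext
    funext p
    refine Eq.trans ?_ (integral_const_mul z _)
    exact integral_congr_ae (Filter.Eventually.of_forall fun s => mul_left_comm _ _ _)

lemma avgSchwartz_apply (f : Schwartz) (p : Cyl) :
    K.avgSchwartz f p = ∫ s, K.weight s * f (p - K.shift s) ∂μ := rfl

lemma dT_avgSchwartz (f : Schwartz) :
    Schwartz.dT (K.avgSchwartz f) = K.avgSchwartz (Schwartz.dT f) :=
  Subtype.ext (K.dT_avgSmooth f)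

lemma dX_avgSchwartz (f : Schwartz) :
    Schwartz.dX (K.avgSchwartz f) = K.avgSchwartz (Schwartz.dX f) :=
  Subtype.ext (K.dX_avgSmooth f)

end Kernel

lemma Smooth.hasDerivAt_fst (f : Smooth) (t : AddCircle (2 * π)) (x s : ℝ) :
    HasDerivAt (fun s : ℝ => (f : Cyl → ℂ) (t + (s : AddCircle (2 * π)), x))
      ((Smooth.dT f : Cyl → ℂ) (t + (s : AddCircle (2 * π)), x)) s := by
  have h1 := f.hasFDerivAt_translate (-t, -x) (s, (0 : ℝ))
  have h2 : HasDerivAt (fun s : ℝ => (s, (0 : ℝ))) ((1 : ℝ), (0 : ℝ)) s :=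
    (hasDerivAt_id s).prodMk (hasDerivAt_const s (0 : ℝ))
  have h3 := h1.comp_hasDerivAt s h2
  simpa [Function.comp_def, add_comm] using h3

lemma Smooth.hasDerivAt_snd (f : Smooth) (t : AddCircle (2 * π)) (x s : ℝ) :
    HasDerivAt (fun s : ℝ => (f : Cyl → ℂ) (t, x + s))
      ((Smooth.dX f : Cyl → ℂ) (t, x + s)) s := by
  have h1 := f.hasFDerivAt_translate (-t, -x) ((0 : ℝ), s)
  have h2 : HasDerivAt (fun s : ℝ => ((0 : ℝ), s)) ((0 : ℝ), (1 : ℝ)) s :=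
    (hasDerivAt_const s (0 : ℝ)).prodMk (hasDerivAt_id s)
  have h3 := h1.comp_hasDerivAt s h2
  simpa [Function.comp_def, add_comm] using h3

/-! ### The operator on Schwartz functions and its inversion on the circle -/

/-- The operator `c₁ ∂ₜ + c₂ ∂ₓ + c₃` on `𝓢(𝕋¹ × ℝ)`. -/
def schwartzOp (c₁ c₂ c₃ : ℂ) : Module.End ℂ Schwartz :=
  c₁ • Schwartz.dT + c₂ • Schwartz.dX + c₃ • LinearMap.id

lemma schwartzOp_apply (c₁ c₂ c₃ : ℂ) (f : Schwartz) :
    schwartzOp c₁ c₂ c₃ f = c₁ • Schwartz.dT f + c₂ • Schwartz.dX f + c₃ • f := rfl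

lemma Kernel.schwartzOp_avgSchwartz {S : Type*} [MeasurableSpace S] {μ : Measure S}
    (K : Kernel μ) (c₁ c₂ c₃ : ℂ) (f : Schwartz) :
    schwartzOp c₁ c₂ c₃ (K.avgSchwartz f) = K.avgSchwartz (schwartzOp c₁ c₂ c₃ f) := by
  simp only [schwartzOp_apply, K.dT_avgSchwartz, K.dX_avgSchwartz, map_add, map_smul]

/-- The kernel of convolution with `s ↦ exp (-q s)`, `0 < s ≤ 2π`, on the torus. -/
def expKernel (q : ℂ) : Kernel ((volume : Measure ℝ).restrict (Set.Ioc 0 (2 * π))) where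
  weight s := Complex.exp (-q * s)
  shift s := (s, 0)
  measurable_shift := (AddCircle.measurable_mk' (a := 2 * π)).prodMk measurable_const
  integrable_moment c := by
    refine Continuous.integrableOn_Ioc ?_
    simp only [abs_zero]
    fun_prop

/-- The integrand is the `s`-derivative of `-exp (-q s) f(t - s, x)`. By periodicity the two
boundary terms carry the same value of `f`, leaving only the difference of the exponentials. -/
lemma expKernel_schwartzOp (q : ℂ) (f : Schwartz) :
    (expKernel q).avgSchwartz (schwartzOp 1 0 q f) =
      (1 - Complex.exp (-q * (2 * π : ℝ))) • f := by
  apply Subtype.ext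
  apply Subtype.ext
  funext p
  have h (s : ℝ) : HasDerivAt
      (fun s : ℝ => -(Complex.exp (-q * s) * f (p.1 - (s : AddCircle (2 * π)), p.2)))
      (Complex.exp (-q * s) * (schwartzOp 1 0 q f) (p - ((s : AddCircle (2 * π)), (0 : ℝ)))) s := by
    have h1 := (f.1.hasDerivAt_fst p.1 p.2 (-s)).scomp s (hasDerivAt_neg s)
    have h2 : HasDerivAt (fun s : ℝ => Complex.exp (-q * s)) (Complex.exp (-q * s) * (-q * 1)) s :=
      ((hasDerivAt_id s).ofReal_comp.const_mul (-q)).cexp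
    have h3 := (h2.mul h1).neg
    simp only [AddCircle.coe_neg, Function.comp_def, ← sub_eq_add_neg] at h3
    refine h3.congr_deriv ?_
    have e : (schwartzOp 1 0 q f) (p - ((s : AddCircle (2 * π)), (0 : ℝ))) =
      (Smooth.dT f.1 : Cyl → ℂ) (p.1 - (s : AddCircle (2 * π)), p.2) +
        q * f (p.1 - (s : AddCircle (2 * π)), p.2) := by
      rw [schwartzOp_apply, one_smul, zero_smul, add_zero, ← sub_zero p.2]
      rfl
    rw [e]
    simp
    ring
  have hcont : Continuous fun s : ℝ =>
      Complex.exp (-q * s) * (schwartzOp 1 0 q f) (p - ((s : AddCircle (2 * π)), (0 : ℝ))) := by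
    refine Continuous.mul (by fun_prop) ((schwartzOp 1 0 q f).1.continuous.comp ?_)
    exact continuous_const.sub ((AddCircle.continuous_mk' (2 * π)).prodMk continuous_const)
  have key := intervalIntegral.integral_eq_sub_of_hasDerivAt (a := 0) (b := 2 * π)
    (fun s _ => h s) (hcont.intervalIntegrable _ _)
  rw [intervalIntegral.integral_of_le Real.two_pi_pos.le] at key
  refine key.trans ?_
  rw [AddCircle.coe_period]
  change _ = (1 - Complex.exp _) * f p
  simp
  ring

/-! ### Inversion of `∂ₓ + z` on the line -/

lemma abs_pow_mul_exp_le {δ : ℝ} (hδ : 0 < δ) (n : ℕ) (s : ℝ) :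
    |s| ^ n * Real.exp (-δ * |s|) ≤ n.factorial / δ ^ n := by
  have h := Real.pow_div_factorial_le_exp (δ * |s|) (by positivity) n
  rw [div_le_iff₀ (by positivity), mul_pow] at h
  rw [le_div_iff₀ (by positivity), neg_mul, Real.exp_neg]
  calc |s| ^ n * (Real.exp (δ * |s|))⁻¹ * δ ^ n
      = (δ ^ n * |s| ^ n) * (Real.exp (δ * |s|))⁻¹ := by ring
    _ ≤ (Real.exp (δ * |s|) * n.factorial) * (Real.exp (δ * |s|))⁻¹ := by gcongr
    _ = n.factorial := by field_simp

lemma integrable_abs_pow_mul_exp {δ : ℝ} (hδ : 0 < δ) (n : ℕ) :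
    Integrable fun s : ℝ => |s| ^ n * Real.exp (-δ * |s|) := by
  -- The constant adds the bounds for the exponents `n` and `n + 2`, so it bounds the integrand
  -- multiplied by `1 + s²`.
  refine (integrable_inv_one_add_sq.const_mul
    (n.factorial / δ ^ n + (n + 2).factorial / δ ^ (n + 2) : ℝ)).mono'
    (by fun_prop) (Filter.Eventually.of_forall fun s => ?_)
  have h0 := abs_pow_mul_exp_le hδ n s
  have h2 := abs_pow_mul_exp_le hδ (n + 2) s
  rw [Real.norm_of_nonneg (by positivity), ← div_eq_mul_inv, le_div_iff₀ (by positivity)]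
  rw [pow_add, sq_abs] at h2
  linarith

/-- The fundamental solution of `d/ds + z` on the line that decays at infinity, for
`Re z ≠ 0`. -/
def lineKernel (z : ℂ) (s : ℝ) : ℂ :=
  if 0 < z.re then (Set.Ioi 0).indicator (fun s : ℝ => Complex.exp (-z * s)) s
  else -(Set.Iic 0).indicator (fun s : ℝ => Complex.exp (-z * s)) s

lemma measurable_lineKernel (z : ℂ) : Measurable (lineKernel z) := by
  have h : Measurable fun s : ℝ => Complex.exp (-z * s) := by fun_prop
  unfold lineKernel
  split_ifs
  · exact h.indicator measurableSet_Ioi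
  · exact (h.indicator measurableSet_Iic).neg

/-- The kernel lives on the half-line where `Re z · s` is nonnegative. Only a lower bound `δ` for
`|Re z|` enters, so the estimate is uniform over a family of `z`. -/
lemma norm_lineKernel_le {z : ℂ} {δ : ℝ} (hz : δ ≤ |z.re|) (s : ℝ) :
    ‖lineKernel z s‖ ≤ Real.exp (-δ * |s|) := by
  unfold lineKernel
  split_ifs with h
  · by_cases hs : s ∈ Set.Ioi (0 : ℝ)
    · rw [Set.indicator_of_mem hs, Complex.norm_exp]
      rw [abs_of_pos h] at hz
      rw [abs_of_pos hs]
      simp only [Complex.mul_re, Complex.neg_re, Complex.ofReal_re, Complex.ofReal_im, mul_zero,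
        sub_zero]
      have := mul_le_mul_of_nonneg_right hz (le_of_lt hs)
      rw [Real.exp_le_exp]
      linarith
    · rw [Set.indicator_of_notMem hs, norm_zero]
      positivity
  · by_cases hs : s ∈ Set.Iic (0 : ℝ)
    · rw [Set.indicator_of_mem hs, norm_neg, Complex.norm_exp]
      rw [abs_of_nonpos (not_lt.1 h)] at hz
      rw [abs_of_nonpos hs]
      simp only [Complex.mul_re, Complex.neg_re, Complex.ofReal_re, Complex.ofReal_im, mul_zero,
        sub_zero]
      have := mul_le_mul_of_nonneg_right hz (neg_nonneg.2 hs)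
      rw [Real.exp_le_exp]
      linarith
    · rw [Set.indicator_of_notMem hs, neg_zero, norm_zero]
      positivity

lemma integrable_lineKernel {z : ℂ} (hz : z.re ≠ 0) : Integrable (lineKernel z) := by
  refine Integrable.mono' (g := fun s : ℝ => Real.exp (-|z.re| * |s|)) ?_
    (measurable_lineKernel z).aestronglyMeasurable
    (Filter.Eventually.of_forall (norm_lineKernel_le le_rfl))
  simpa using integrable_abs_pow_mul_exp (abs_pos.2 hz) 0

/-- The integrand is the derivative of `-exp (-z s) f(t, x - s)` on a half-line. This primitive
tends to zero at the infinite end, and the end `s = 0` yields `f(t, x)`; the minus sign in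
`lineKernel` for `Re z < 0` corrects the orientation. -/
lemma integral_lineKernel_mul {z : ℂ} (hz : z.re ≠ 0) (f : Schwartz) (t : AddCircle (2 * π))
    (x : ℝ) : ∫ s : ℝ, lineKernel z s * (schwartzOp 0 1 z f) (t, x - s) = f (t, x) := by
  have h (s : ℝ) : HasDerivAt
      (fun s : ℝ => -(Complex.exp (-z * s) * f (t, x - s)))
      (Complex.exp (-z * s) * (schwartzOp 0 1 z f) (t, x - s)) s := by
    have h1 := (f.1.hasDerivAt_snd t x (-s)).scomp s (hasDerivAt_neg s)
    have h2 : HasDerivAt (fun s : ℝ => Complex.exp (-z * s)) (Complex.exp (-z * s) * (-z * 1)) s :=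
      ((hasDerivAt_id s).ofReal_comp.const_mul (-z)).cexp
    have h3 := (h2.mul h1).neg
    simp only [Function.comp_def, ← sub_eq_add_neg] at h3
    refine h3.congr_deriv ?_
    have e : (schwartzOp 0 1 z f) (t, x - s) =
      (Smooth.dX f.1 : Cyl → ℂ) (t, x - s) + z * f (t, x - s) := by
      rw [schwartzOp_apply, one_smul, zero_smul, zero_add]
      rfl
    rw [e]
    simp
    ring
  have hi : Integrable fun s : ℝ => lineKernel z s * (schwartzOp 0 1 z f) (t, x - s) := by
    refine (integrable_lineKernel hz).mul_bdd (c := (schwartzOp 0 1 z f).seminorm 0 0 0)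
      (Continuous.aestronglyMeasurable ?_)
      (Filter.Eventually.of_forall fun s => (schwartzOp 0 1 z f).norm_le _)
    exact (schwartzOp 0 1 z f).1.continuous.comp (by fun_prop)
  have hlim (l : Filter ℝ) (hl : Filter.Tendsto (fun s : ℝ => z.re * s) l Filter.atTop) :
      Filter.Tendsto (fun s : ℝ => -(Complex.exp (-z * s) * f (t, x - s))) l (nhds 0) := by
    refine squeeze_zero_norm (a := fun s : ℝ => Real.exp (-(z.re * s)) * f.seminorm 0 0 0)
      (fun s => ?_) ?_
    · rw [norm_neg, norm_mul, Complex.norm_exp]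
      simp only [Complex.mul_re, Complex.neg_re, Complex.ofReal_re, Complex.ofReal_im, mul_zero,
        sub_zero, neg_mul]
      gcongr
      exact f.norm_le _
    · simpa using (Real.tendsto_exp_neg_atTop_nhds_zero.comp hl).mul_const (f.seminorm 0 0 0)
  by_cases hp : 0 < z.re
  · have e (s : ℝ) : lineKernel z s * (schwartzOp 0 1 z f) (t, x - s) = (Set.Ioi 0).indicator
        (fun s : ℝ => Complex.exp (-z * s) * (schwartzOp 0 1 z f) (t, x - s)) s := by
      simp only [lineKernel, if_pos hp, Set.indicator_mul_left]
    simp only [e] at hi ⊢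
    rw [integral_indicator measurableSet_Ioi, integral_Ioi_of_hasDerivAt_of_tendsto'
      (fun s _ => h s) ((integrable_indicator_iff measurableSet_Ioi).1 hi)
      (hlim _ (Filter.tendsto_id.const_mul_atTop hp))]
    simp
  · have hn : z.re < 0 := lt_of_le_of_ne (not_lt.1 hp) hz
    have e (s : ℝ) : lineKernel z s * (schwartzOp 0 1 z f) (t, x - s) = -(Set.Iic 0).indicator
        (fun s : ℝ => Complex.exp (-z * s) * (schwartzOp 0 1 z f) (t, x - s)) s := by
      simp only [lineKernel, if_neg hp, Set.indicator_mul_left, neg_mul]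
    simp only [e] at hi ⊢
    rw [integral_neg, integral_indicator measurableSet_Iic, integral_Iic_of_hasDerivAt_of_tendsto'
      (fun s _ => h s) ((integrable_indicator_iff measurableSet_Iic).1 (integrable_neg_iff.1 hi))
      (hlim _ (Filter.tendsto_id.const_mul_atBot_of_neg hn))]
    simp

/-! ### Fourier modes in the circle variable -/

lemma fourier_apply_add (k : ℤ) (s t : AddCircle (2 * π)) :
    fourier k (s + t) = fourier k s * fourier k t := by
  simp only [fourier_apply, zsmul_add, AddCircle.toCircle_add, Circle.coe_mul]

lemma norm_fourier_apply (k : ℤ) (t : AddCircle (2 * π)) : ‖fourier k t‖ = 1 := by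
  rw [fourier_apply, Circle.norm_coe]

lemma hasDerivAt_fourier_zero (k : ℤ) :
    HasDerivAt (fun s : ℝ => fourier k (s : AddCircle (2 * π))) (Complex.I * k) 0 := by
  have h := hasDerivAt_fourier (2 * π) k 0
  refine h.congr_deriv ?_
  have : (π : ℂ) ≠ 0 := by exact_mod_cast Real.pi_ne_zero
  simp
  field_simp

/-- The kernel of the projection to the `k`-th Fourier mode on the torus. -/
def modeKernel (k : ℤ) : Kernel (AddCircle.haarAddCircle (T := 2 * π)) where
  weight s := fourier k s
  shift s := (s, 0)
  measurable_shift := measurable_id.prodMk measurable_const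
  integrable_moment c := by
    refine (integrable_const ((0 : ℝ) ^ c)).mono' (by fun_prop)
      (Filter.Eventually.of_forall fun s => ?_)
    rw [norm_mul, norm_fourier_apply]
    simp

/-- The projection to the `k`-th Fourier mode on the torus. -/
abbrev modeProj (k : ℤ) : Module.End ℂ Schwartz := (modeKernel k).avgSchwartz

lemma modeProj_apply (k : ℤ) (f : Schwartz) (t : AddCircle (2 * π)) (x : ℝ) :
    modeProj k f (t, x) = fourier k t * fourierCoeff (fun τ => f (τ, x)) k := by
  have h := integral_sub_left_eq_self
    (fun s : AddCircle (2 * π) => fourier k (t - s) * f (s, x)) AddCircle.haarAddCircle t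
  have e : modeProj k f (t, x) = ∫ s, fourier k s * f (t - s, x) ∂AddCircle.haarAddCircle := by
    rw [Kernel.avgSchwartz_apply]
    simp [modeKernel]
  rw [e, fourierCoeff, ← integral_const_mul]
  simp only [sub_sub_cancel] at h
  rw [h]
  refine integral_congr_ae (Filter.Eventually.of_forall fun s => ?_)
  have h2 := fourier_apply_add k t (-s)
  simp only [sub_eq_add_neg, h2, smul_eq_mul]
  rw [mul_assoc]
  simp [fourier_apply]

/-- The projection commutes with `∂ₜ`, and its values depend on `t` only through the factor `fourier
k t`. -/
lemma modeProj_dT (k : ℤ) (f : Schwartz) :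
    modeProj k (Schwartz.dT f) = (Complex.I * k) • modeProj k f := by
  rw [← Kernel.dT_avgSchwartz]
  apply Subtype.ext
  apply Subtype.ext
  funext p
  have h1 := (modeProj k f).1.hasDerivAt_fst p.1 p.2 0
  have e (s : ℝ) : (modeProj k f) (p.1 + (s : AddCircle (2 * π)), p.2) =
      fourier k (s : AddCircle (2 * π)) * modeProj k f p := by
    rw [← Prod.mk.eta (p := p), modeProj_apply, modeProj_apply, fourier_apply_add]
    ring
  simp only [e] at h1
  have h2 := (hasDerivAt_fourier_zero k).mul_const (modeProj k f p)
  have h3 := h1.unique h2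
  simp only [AddCircle.coe_zero, add_zero] at h3
  exact h3

lemma one_add_sq_mul_modeProj (k : ℤ) (f : Schwartz) :
    modeProj k (f + (-1 : ℂ) • Schwartz.dT (Schwartz.dT f)) = ((1 + (k : ℂ) ^ 2)) • modeProj k f := by
  rw [map_add, map_smul, modeProj_dT, modeProj_dT, smul_smul, smul_smul, add_smul, one_smul]
  congr 2
  linear_combination -(k : ℂ) ^ 2 * Complex.I_sq

lemma summable_inv_one_add_int_sq : Summable fun k : ℤ => (1 + (k : ℝ) ^ 2)⁻¹ := by
  have h : Summable fun k : ℕ => (1 + (k : ℝ) ^ 2)⁻¹ := by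
    rw [← summable_nat_add_iff 1]
    refine Summable.of_nonneg_of_le (fun _ => by positivity) (fun k => ?_)
      ((summable_nat_add_iff 1).2 (Real.summable_nat_pow_inv.2 (by norm_num : 1 < 2)))
    gcongr
    linarith
  refine Summable.of_nat_of_neg ?_ ?_ <;> simpa using h

lemma one_add_int_sq_ne_zero (k : ℤ) : (1 + (k : ℂ) ^ 2) ≠ 0 := by
  have h : (1 + (k : ℝ) ^ 2) ≠ 0 := by positivity
  exact_mod_cast h

/-- On the `k`-th mode `1 - ∂ₜ²` is multiplication by `1 + k²`, while the projection does not
increase the sup norm. Hence the Fourier coefficients are summable. -/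
lemma modeProj_norm_le (k : ℤ) (f : Schwartz) (p : Cyl) :
    ‖modeProj k f p‖ ≤
      (1 + (k : ℝ) ^ 2)⁻¹ * (f + (-1 : ℂ) • Schwartz.dT (Schwartz.dT f)).seminorm 0 0 0 := by
  set g := f + (-1 : ℂ) • Schwartz.dT (Schwartz.dT f) with hg
  have h1 : ‖modeProj k g p‖ ≤ g.seminorm 0 0 0 := by
    rw [Kernel.avgSchwartz_apply]
    refine (norm_integral_le_of_norm_le_const (C := g.seminorm 0 0 0)
      (Filter.Eventually.of_forall fun s => ?_)).trans ?_
    · rw [norm_mul]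
      have : ‖(modeKernel k).weight s‖ = 1 := norm_fourier_apply k s
      rw [this, one_mul]
      exact g.norm_le _
    · simp
  have h2 : modeProj k g p = (1 + (k : ℂ) ^ 2) * modeProj k f p := by
    rw [hg, one_add_sq_mul_modeProj]
    rfl
  have h3 : ‖(1 + (k : ℂ) ^ 2)‖ = 1 + (k : ℝ) ^ 2 := by
    have : (1 + (k : ℂ) ^ 2) = ((1 + (k : ℝ) ^ 2 : ℝ) : ℂ) := by push_cast; rfl
    rw [this, Complex.norm_real, Real.norm_of_nonneg (by positivity)]
  rw [h2, norm_mul, h3] at h1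
  rw [inv_mul_eq_div, le_div_iff₀ (by positivity)]
  linarith

lemma hasSum_modeProj (f : Schwartz) (p : Cyl) : HasSum (fun k => modeProj k f p) (f p) := by
  obtain ⟨t, x⟩ := p
  let F : C(AddCircle (2 * π), ℂ) := ⟨fun τ => f (τ, x), f.1.continuous.comp (by fun_prop)⟩
  have hs : Summable (fourierCoeff F) := by
    refine Summable.of_norm_bounded (summable_inv_one_add_int_sq.mul_right
      ((f + (-1 : ℂ) • Schwartz.dT (Schwartz.dT f)).seminorm 0 0 0)) fun k => ?_
    have h := modeProj_norm_le k f (0, x)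
    rw [modeProj_apply, norm_mul, norm_fourier_apply, one_mul] at h
    exact h
  have h := has_pointwise_sum_fourier_series_of_summable hs t
  simp only [smul_eq_mul, mul_comm (fourierCoeff _ _)] at h
  simpa only [modeProj_apply] using! h

/-! ### The parametrix on the cylinder and surjectivity -/

/-- The kernel of a parametrix of `a ∂ₜ + ∂ₓ + q`: convolution with it inverts
`a ∂ₜ + ∂ₓ + q` up to the factor `1 - ∂ₜ²`. -/
def cylinderKernel (a q : ℂ) {δ : ℝ} (hδ : 0 < δ)
    (h : ∀ k : ℤ, δ ≤ |(Complex.I * a * k + q).re|) :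
    Kernel (((Measure.count : Measure ℤ).prod (volume : Measure ℝ)).prod
      (AddCircle.haarAddCircle (T := 2 * π))) where
  weight s := (1 + (s.1.1 : ℂ) ^ 2)⁻¹ * lineKernel (Complex.I * a * s.1.1 + q) s.1.2 *
    fourier s.1.1 s.2
  shift s := (s.2, s.1.2)
  measurable_shift := measurable_snd.prodMk (measurable_snd.comp measurable_fst)
  integrable_moment c := by
    have hk : Integrable (fun k : ℤ => (1 + (k : ℝ) ^ 2)⁻¹) Measure.count :=
      integrable_count_iff.2 summable_inv_one_add_int_sq.norm
    have hb := (hk.mul_prod (integrable_abs_pow_mul_exp hδ c)).mul_prod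
      (integrable_const (μ := AddCircle.haarAddCircle (T := 2 * π)) (1 : ℝ))
    refine hb.mono' (Measurable.aestronglyMeasurable ?_)
      (Filter.Eventually.of_forall fun s => ?_)
    · have h1 : Measurable fun s : ℤ × ℝ =>
          (1 + (s.1 : ℂ) ^ 2)⁻¹ * lineKernel (Complex.I * a * s.1 + q) s.2 :=
        measurable_from_prod_countable_right fun k =>
          (measurable_lineKernel (Complex.I * a * k + q)).const_mul (1 + (k : ℂ) ^ 2)⁻¹
      have h2 : Measurable fun s : ℤ × AddCircle (2 * π) => fourier s.1 s.2 :=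
        measurable_from_prod_countable_right fun k => (map_continuous (fourier k)).measurable
      have h3 : Measurable fun s : (ℤ × ℝ) × AddCircle (2 * π) => (s.1.1, s.2) := by fun_prop
      exact Measurable.mul (by fun_prop) ((h1.comp measurable_fst).mul (h2.comp h3))
    · have h3 : ‖(1 + (s.1.1 : ℂ) ^ 2)‖ = 1 + (s.1.1 : ℝ) ^ 2 := by
        have : (1 + (s.1.1 : ℂ) ^ 2) = ((1 + (s.1.1 : ℝ) ^ 2 : ℝ) : ℂ) := by push_cast; rfl
        rw [this, Complex.norm_real, Real.norm_of_nonneg (by positivity)]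
      rw [norm_mul, norm_mul, norm_mul, norm_fourier_apply, norm_inv, h3, Complex.norm_real,
        Real.norm_of_nonneg (by positivity)]
      have := norm_lineKernel_le (h s.1.1) s.1.2
      calc _ = (1 + (s.1.1 : ℝ) ^ 2)⁻¹ * (|s.1.2| ^ c *
            ‖lineKernel (Complex.I * a * s.1.1 + q) s.1.2‖) * 1 := by ring
        _ ≤ _ := by gcongr

lemma modeProj_schwartzOp (a q : ℂ) (k : ℤ) (f : Schwartz) :
    modeProj k (schwartzOp a 1 q f) = schwartzOp 0 1 (Complex.I * a * k + q) (modeProj k f) := by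
  rw [schwartzOp_apply, schwartzOp_apply, map_add, map_add, map_smul, map_smul, map_smul,
    modeProj_dT, Kernel.dX_avgSchwartz, smul_smul, zero_smul, zero_add, add_smul, ← add_assoc]
  rw [add_comm (_ • _) ((1 : ℂ) • _)]
  congr 3
  ring

/-- By Fubini, the circle integral projects to the mode `k`, the line integral inverts `∂ₓ + i a k +
q` there, and the weight `(1 + k²)⁻¹` cancels `1 - ∂ₜ²`. Summing over `k` reassembles the Fourier
series of `f`. -/
lemma cylinderKernel_schwartzOp (a q : ℂ) {δ : ℝ} (hδ : 0 < δ)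
    (h : ∀ k : ℤ, δ ≤ |(Complex.I * a * k + q).re|) (f : Schwartz) :
    (cylinderKernel a q hδ h).avgSchwartz
      (schwartzOp a 1 q (f + (-1 : ℂ) • Schwartz.dT (Schwartz.dT f))) = f := by
  set g := f + (-1 : ℂ) • Schwartz.dT (Schwartz.dT f) with hg
  set G := schwartzOp a 1 q g with hG
  apply Subtype.ext
  apply Subtype.ext
  funext p
  have hz (k : ℤ) : (Complex.I * a * k + q).re ≠ 0 := by
    intro h0
    have := h k
    rw [h0, abs_zero] at this
    linarith
  have hi := (cylinderKernel a q hδ h).integrable_avg G p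
  have hmode (s : ℤ × ℝ) : ∫ τ, (cylinderKernel a q hδ h).weight (s, τ) *
      G (p - (cylinderKernel a q hδ h).shift (s, τ)) ∂AddCircle.haarAddCircle =
      (1 + (s.1 : ℂ) ^ 2)⁻¹ * (lineKernel (Complex.I * a * s.1 + q) s.2 *
        schwartzOp 0 1 (Complex.I * a * s.1 + q) (modeProj s.1 g) (p.1, p.2 - s.2)) := by
    rw [← modeProj_schwartzOp, ← hG, Kernel.avgSchwartz_apply, ← mul_assoc, ← integral_const_mul]
    refine integral_congr_ae (Filter.Eventually.of_forall fun τ => ?_)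
    simp only [cylinderKernel, modeKernel, mul_assoc]
    congr 3
    simp
    rfl
  have h1 := integral_prod _ hi
  have hi1 := hi.integral_prod_left
  simp only [hmode] at h1 hi1
  have h2 := integral_prod _ hi1
  have hi2 := hi1.integral_prod_left
  have hline (k : ℤ) : ∫ s : ℝ, (1 + (k : ℂ) ^ 2)⁻¹ * (lineKernel (Complex.I * a * k + q) s *
        schwartzOp 0 1 (Complex.I * a * k + q) (modeProj k g) (p.1, p.2 - s)) =
      modeProj k f p := by
    rw [integral_const_mul, integral_lineKernel_mul (hz k), hg, one_add_sq_mul_modeProj]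
    change _ * ((1 + (k : ℂ) ^ 2) * modeProj k f p) = _
    rw [inv_mul_cancel_left₀ (one_add_int_sq_ne_zero k)]
  simp only [hline] at h2 hi2
  rw [integral_countable hi2] at h2
  refine h1.trans (h2.trans ?_)
  simpa using (hasSum_modeProj f p).tsum_eq

/-- The values are those of an arithmetic progression, so the one nearest to zero gives the bound;
for `α ≠ 0` it is attained at the integer nearest to `-β / α`. -/
lemma exists_le_abs_of_affine_int_ne_zero (α β : ℝ) (h : ∀ k : ℤ, α * k + β ≠ 0) :
    ∃ δ : ℝ, 0 < δ ∧ ∀ k : ℤ, δ ≤ |α * k + β| := by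
  by_cases hα : α = 0
  · subst hα
    refine ⟨|β|, abs_pos.2 (by simpa using h 0), fun k => by simp⟩
  · have e (k : ℤ) : α * k + β = -(α * (-β / α - k)) := by field_simp; ring
    refine ⟨|α| * |-β / α - round (-β / α)|, ?_, fun k => ?_⟩
    · rw [← abs_mul, ← abs_neg, ← e]
      exact abs_pos.2 (h _)
    · rw [e, abs_neg, abs_mul]
      exact mul_le_mul_of_nonneg_left (round_le (-β / α) k) (abs_nonneg α)

/-- `c₁ ∂ₜ + c₂ ∂ₓ + c₃` maps `𝓢(𝕋¹ × ℝ)` onto itself if its symbol has no zeros. -/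
lemma schwartzOp_surjective {c₁ c₂ c₃ : ℂ} (hc : c₁ ≠ 0 ∨ c₂ ≠ 0)
    (h : ∀ (k : ℤ) (ξ : ℝ), c₁ * (k : ℂ) + c₂ * (ξ : ℂ) - Complex.I * c₃ ≠ 0) :
    Function.Surjective (schwartzOp c₁ c₂ c₃) := by
  intro f
  by_cases h2 : c₂ = 0
  · have h1 : c₁ ≠ 0 := hc.resolve_right (not_not.2 h2)
    subst h2
    -- Otherwise `c₃ / c₁ = -i n` for an integer `n`, and the symbol vanishes at `(n, 0)`.
    have he : 1 - Complex.exp (-(c₃ / c₁) * (2 * π : ℝ)) ≠ 0 := by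
      intro h0
      obtain ⟨n, hn⟩ := Complex.exp_eq_one_iff.1 (sub_eq_zero.1 h0).symm
      refine h n 0 ?_
      have hpi : (π : ℂ) ≠ 0 := by exact_mod_cast Real.pi_ne_zero
      have h3 : c₃ = -(n * Complex.I) * c₁ := by
        have : -(c₃ / c₁) * (2 * π) = (n * Complex.I) * (2 * π) := by
          push_cast at hn
          linear_combination hn
        have := mul_right_cancel₀ (by simp) this
        field_simp at this
        linear_combination -this
      rw [h3]
      push_cast
      linear_combination (n : ℂ) * c₁ * Complex.I_sq
    refine ⟨(c₁ * (1 - Complex.exp (-(c₃ / c₁) * (2 * π : ℝ))))⁻¹ •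
      (expKernel (c₃ / c₁)).avgSchwartz f, ?_⟩
    have e : schwartzOp c₁ 0 c₃ = c₁ • schwartzOp 1 0 (c₃ / c₁) := by
      simp only [schwartzOp, smul_add, smul_smul, mul_one, mul_zero, mul_div_cancel₀ _ h1]
    rw [map_smul, e, LinearMap.smul_apply, Kernel.schwartzOp_avgSchwartz, expKernel_schwartzOp,
      smul_smul, smul_smul, mul_assoc, inv_mul_cancel₀ (mul_ne_zero h1 he), one_smul]
  · have hre (k : ℤ) : (Complex.I * (c₁ / c₂) * k + c₃ / c₂).re =
        -(c₁ / c₂).im * k + (c₃ / c₂).re := by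
      simp
    obtain ⟨δ, hδ, hk⟩ := exists_le_abs_of_affine_int_ne_zero (-(c₁ / c₂).im) (c₃ / c₂).re (by
      intro k h0
      rw [← hre] at h0
      -- If `w = i (c₁ / c₂) k + c₃ / c₂` is purely imaginary, the real number `ξ = -Im w` solves `i
      -- c₁ k + i c₂ ξ + c₃ = 0`, a zero of the symbol.
      refine h k (-(Complex.I * (c₁ / c₂) * k + c₃ / c₂).im) ?_
      set w := Complex.I * (c₁ / c₂) * k + c₃ / c₂ with hw
      have e1 : w = w.im * Complex.I := by
        apply Complex.ext <;> simp [h0]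
      have e2 : c₂ * w = Complex.I * c₁ * k + c₃ := by
        rw [hw]; field_simp
      push_cast
      linear_combination Complex.I * e2 - Complex.I * c₂ * e1 +
        (c₁ * k - c₂ * w.im) * Complex.I_sq)
    simp only [← hre] at hk
    refine ⟨c₂⁻¹ • (cylinderKernel (c₁ / c₂) (c₃ / c₂) hδ hk).avgSchwartz
      (f + (-1 : ℂ) • Schwartz.dT (Schwartz.dT f)), ?_⟩
    have e : schwartzOp c₁ c₂ c₃ = c₂ • schwartzOp (c₁ / c₂) 1 (c₃ / c₂) := by
      simp only [schwartzOp, smul_add, smul_smul, mul_one, mul_div_cancel₀ _ h2]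
    rw [map_smul, e, LinearMap.smul_apply, Kernel.schwartzOp_avgSchwartz,
      cylinderKernel_schwartzOp, smul_smul, inv_mul_cancel₀ h2, one_smul]

/-! ### Bounded smooth functions as functionals: integration by parts -/

lemma Smooth.integrable_mul {h : Smooth} (hb : ∃ C, ∀ p, ‖(h : Cyl → ℂ) p‖ ≤ C) (f : Schwartz) :
    Integrable fun p => (h : Cyl → ℂ) p * f p := by
  obtain ⟨C, hC⟩ := hb
  exact f.integrable.bdd_mul h.continuous.aestronglyMeasurable (Filter.Eventually.of_forall hC)

lemma Smooth.integral_mul_dT {h : Smooth} (hb : ∃ C, ∀ p, ‖(h : Cyl → ℂ) p‖ ≤ C)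
    (hb' : ∃ C, ∀ p, ‖(Smooth.dT h : Cyl → ℂ) p‖ ≤ C) (f : Schwartz) :
    ∫ p : Cyl, (h : Cyl → ℂ) p * Schwartz.dT f p =
      -∫ p : Cyl, (Smooth.dT h : Cyl → ℂ) p * f p := by
  have i1 := Smooth.integrable_mul hb' f
  have i2 := Smooth.integrable_mul hb (Schwartz.dT f)
  have hd (x s : ℝ) := (h.hasDerivAt_fst 0 x s).mul (f.1.hasDerivAt_fst 0 x s)
  have key : ∫ p : Cyl, ((Smooth.dT h : Cyl → ℂ) p * f p +
      (h : Cyl → ℂ) p * Schwartz.dT f p) = 0 := by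
    refine (integral_prod_symm _ (i1.add i2)).trans ?_
    refine integral_eq_zero_of_ae (Filter.Eventually.of_forall fun x => ?_)
    refine (AddCircle.intervalIntegral_preimage (2 * π) 0 _).symm.trans ?_
    have e := intervalIntegral.integral_eq_sub_of_hasDerivAt (a := 0) (b := 0 + 2 * π)
      (fun s _ => hd x s) (Continuous.intervalIntegrable ?_ _ _)
    · have h0 : ((0 + 2 * π : ℝ) : AddCircle (2 * π)) = ((0 : ℝ) : AddCircle (2 * π)) := by
        rw [zero_add, AddCircle.coe_period, AddCircle.coe_zero]
      simp only [Pi.mul_apply, h0, sub_self] at e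
      simp only [zero_add (_ : AddCircle (2 * π))] at e
      exact e
    · have hc : Continuous fun s : ℝ => ((0 : AddCircle (2 * π)) + (s : AddCircle (2 * π)), x) :=
        (continuous_const.add (AddCircle.continuous_mk' (2 * π))).prodMk continuous_const
      exact (((Smooth.dT h).continuous.comp hc).mul (f.1.continuous.comp hc)).add
        ((h.continuous.comp hc).mul ((Smooth.dT f.1).continuous.comp hc))
  rw [integral_add i1 i2] at key
  exact eq_neg_of_add_eq_zero_right key

lemma Smooth.integral_mul_dX {h : Smooth} (hb : ∃ C, ∀ p, ‖(h : Cyl → ℂ) p‖ ≤ C)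
    (hb' : ∃ C, ∀ p, ‖(Smooth.dX h : Cyl → ℂ) p‖ ≤ C) (f : Schwartz) :
    ∫ p : Cyl, (h : Cyl → ℂ) p * Schwartz.dX f p =
      -∫ p : Cyl, (Smooth.dX h : Cyl → ℂ) p * f p := by
  have i0 := Smooth.integrable_mul hb f
  have i1 := Smooth.integrable_mul hb' f
  have i2 := Smooth.integrable_mul hb (Schwartz.dX f)
  have hd (t : AddCircle (2 * π)) (s : ℝ) :=
    (h.hasDerivAt_snd t 0 s).mul (f.1.hasDerivAt_snd t 0 s)
  have key : ∫ p : Cyl, ((Smooth.dX h : Cyl → ℂ) p * f p +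
      (h : Cyl → ℂ) p * Schwartz.dX f p) = 0 := by
    refine (integral_prod _ (i1.add i2)).trans ?_
    refine integral_eq_zero_of_ae ?_
    -- On almost every line `t = const` both the product and its derivative are integrable, which
    -- forces the integral of the derivative to vanish.
    filter_upwards [i0.prod_right_ae, (i1.add i2).prod_right_ae] with t h0 h1
    have e := integral_eq_zero_of_hasDerivAt_of_integrable (hd t)
    simp only [zero_add (_ : ℝ)] at e
    exact e h1 (by simpa only [Pi.mul_def, zero_add (_ : ℝ)] using h0)
  rw [integral_add i1 i2] at key
  exact eq_neg_of_add_eq_zero_right key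

lemma integral_linear_combination {F G H : Cyl → ℂ} (hF : Integrable F) (hG : Integrable G)
    (hH : Integrable H) (a b c : ℂ) :
    ∫ p, (a * F p + b * G p + c * H p) =
      a * (∫ p, F p) + b * (∫ p, G p) + c * ∫ p, H p := by
  have h1 := integral_add (hF.const_mul a) (hG.const_mul b)
  have h2 := integral_add ((hF.const_mul a).add (hG.const_mul b)) (hH.const_mul c)
  simp only [Pi.add_apply] at h2
  rw [h2, h1, integral_const_mul, integral_const_mul, integral_const_mul]

lemma Smooth.integral_mul_schwartzOp {h : Smooth} (hb : ∃ C, ∀ p, ‖(h : Cyl → ℂ) p‖ ≤ C)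
    (hT : ∃ C, ∀ p, ‖(Smooth.dT h : Cyl → ℂ) p‖ ≤ C)
    (hX : ∃ C, ∀ p, ‖(Smooth.dX h : Cyl → ℂ) p‖ ≤ C) (c₁ c₂ c₃ : ℂ) (f : Schwartz) :
    ∫ p : Cyl, (h : Cyl → ℂ) p * schwartzOp (-c₁) (-c₂) c₃ f p =
      ∫ p : Cyl, (c₁ * (Smooth.dT h : Cyl → ℂ) p + c₂ * (Smooth.dX h : Cyl → ℂ) p +
        c₃ * (h : Cyl → ℂ) p) * f p := by
  have e1 (p : Cyl) : (h : Cyl → ℂ) p * schwartzOp (-c₁) (-c₂) c₃ f p =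
      -c₁ * ((h : Cyl → ℂ) p * Schwartz.dT f p) + -c₂ * ((h : Cyl → ℂ) p * Schwartz.dX f p) +
        c₃ * ((h : Cyl → ℂ) p * f p) := by
    have : schwartzOp (-c₁) (-c₂) c₃ f p =
      -c₁ * Schwartz.dT f p + -c₂ * Schwartz.dX f p + c₃ * f p := rfl
    rw [this]
    ring
  have e2 (p : Cyl) : (c₁ * (Smooth.dT h : Cyl → ℂ) p + c₂ * (Smooth.dX h : Cyl → ℂ) p +
        c₃ * (h : Cyl → ℂ) p) * f p = c₁ * ((Smooth.dT h : Cyl → ℂ) p * f p) +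
        c₂ * ((Smooth.dX h : Cyl → ℂ) p * f p) + c₃ * ((h : Cyl → ℂ) p * f p) := by ring
  have i0 := Smooth.integrable_mul hb f
  have iT := Smooth.integrable_mul hb (Schwartz.dT f)
  have iX := Smooth.integrable_mul hb (Schwartz.dX f)
  have jT := Smooth.integrable_mul hT f
  have jX := Smooth.integrable_mul hX f
  simp only [e1, e2]
  rw [integral_linear_combination iT iX i0, integral_linear_combination jT jX i0]
  rw [Smooth.integral_mul_dT hb hT, Smooth.integral_mul_dX hb hX]
  ring

lemma firstOrderOp_apply (c₁ c₂ c₃ : ℂ) (u : Tempered) (f : Schwartz) :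
    (firstOrderOp c₁ c₂ c₃ u).1 f = u.1 (schwartzOp (-c₁) (-c₂) c₃ f) := by
  rw [schwartzOp_apply, map_add, map_add, map_smul, map_smul, map_smul]
  change c₁ * -u.1 (Schwartz.dT f) + c₂ * -u.1 (Schwartz.dX f) + c₃ * u.1 f =
    -c₁ * u.1 (Schwartz.dT f) + -c₂ * u.1 (Schwartz.dX f) + c₃ * u.1 f
  ring

lemma firstOrderOp_toTempered (c₁ c₂ c₃ : ℂ) (g : Schwartz) :
    firstOrderOp c₁ c₂ c₃ g.toTempered = (schwartzOp c₁ c₂ c₃ g).toTempered := by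
  apply Subtype.ext
  refine LinearMap.ext fun f => ?_
  rw [firstOrderOp_apply]
  exact Smooth.integral_mul_schwartzOp (h := g.1) ⟨_, g.norm_le⟩
    ⟨_, (Schwartz.dT g).norm_le⟩ ⟨_, (Schwartz.dX g).norm_le⟩ c₁ c₂ c₃ f

/-- A bounded smooth function acts on `𝓢(𝕋¹ × ℝ)` by integration. -/
def Smooth.toTempered (h : Smooth) (hb : ∃ C, ∀ p, ‖(h : Cyl → ℂ) p‖ ≤ C) : Tempered :=
  ⟨{ toFun := fun f => ∫ p : Cyl, (h : Cyl → ℂ) p * f p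
     map_add' := fun f₁ f₂ => by
       rw [← integral_add (Smooth.integrable_mul hb f₁) (Smooth.integrable_mul hb f₂)]
       congr 1
       funext p
       exact mul_add _ _ _
     map_smul' := fun z f => by
       rw [RingHom.id_apply, ← integral_smul]
       congr 1
       funext p
       exact mul_left_comm _ _ _ },
   by
    obtain ⟨C, hC⟩ := hb
    -- Order `2` suffices: `(1 + x²) |f|` is bounded by two of the seminorms in `p_2`, and `(1 +
    -- x²)⁻¹` is integrable on the cylinder.
    refine ⟨2, ∫ p : Cyl, C * 2 * (1 + p.2 ^ 2)⁻¹, fun f => ?_⟩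
    have hi : Integrable (fun p : Cyl => C * 2 * (1 + p.2 ^ 2)⁻¹) :=
      (integrable_inv_one_add_sq.comp_snd (volume : Measure (AddCircle (2 * π)))).const_mul _
    rw [← integral_mul_const]
    refine norm_integral_le_of_norm_le (hi.mul_const _) (Filter.Eventually.of_forall fun p => ?_)
    have h0 := (f.norm_le p).trans (Schwartz.seminorm_le_pNorm (N := 2) (by norm_num) f)
    have h2 := (f.weighted_le 0 0 2 p).trans (Schwartz.seminorm_le_pNorm (N := 2) (by norm_num) f)
    simp only [weighted, Smooth.iterD, pow_zero, mul_one, Module.End.one_apply, sq_abs] at h2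
    have h3 : ‖f p‖ ≤ 2 * (1 + p.2 ^ 2)⁻¹ * f.pNorm 2 := by
      rw [mul_right_comm, ← div_eq_mul_inv, le_div_iff₀ (by positivity)]
      linarith
    rw [norm_mul]
    calc _ ≤ C * (2 * (1 + p.2 ^ 2)⁻¹ * f.pNorm 2) :=
          mul_le_mul (hC p) h3 (norm_nonneg _) ((norm_nonneg _).trans (hC p))
      _ = _ := by ring⟩

/-! ### Characters are tempered but not Schwartz -/

/-- The character `(t, x) ↦ exp (i (k t + ξ x))`. -/
def character (k : ℤ) (ξ : ℝ) : Smooth :=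
  ⟨fun p => fourier k p.1 * Complex.exp (Complex.I * ξ * p.2), by
    change ContDiff ℝ ∞ (lift _)
    have e : lift (fun p : Cyl => fourier k p.1 * Complex.exp (Complex.I * ξ * p.2)) =
        fun r : ℝ × ℝ => Complex.exp (2 * π * Complex.I * k * (Complex.ofRealCLM r.1) /
          (2 * π : ℝ)) * Complex.exp (Complex.I * ξ * Complex.ofRealCLM r.2) := by
      funext r
      simp only [lift, fourier_coe_apply]
      rfl
    rw [e]
    fun_prop⟩

lemma character_apply (k : ℤ) (ξ : ℝ) (p : Cyl) :
    (character k ξ : Cyl → ℂ) p = fourier k p.1 * Complex.exp (Complex.I * ξ * p.2) := rfl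

lemma norm_character (k : ℤ) (ξ : ℝ) (p : Cyl) : ‖(character k ξ : Cyl → ℂ) p‖ = 1 := by
  rw [character_apply, norm_mul, norm_fourier_apply, Complex.norm_exp]
  simp

lemma character_mul_neg (k : ℤ) (ξ : ℝ) (p : Cyl) :
    (character k ξ : Cyl → ℂ) p * (character (-k) (-ξ) : Cyl → ℂ) p = 1 := by
  rw [character_apply, character_apply, mul_mul_mul_comm, ← fourier_add, ← Complex.exp_add]
  simp

lemma dT_character (k : ℤ) (ξ : ℝ) :
    Smooth.dT (character k ξ) = (Complex.I * k) • character k ξ := by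
  apply Subtype.ext
  funext p
  have e (s : ℝ) : (character k ξ : Cyl → ℂ) (p.1 + (s : AddCircle (2 * π)), p.2) =
      fourier k (s : AddCircle (2 * π)) * (character k ξ : Cyl → ℂ) p := by
    rw [character_apply, character_apply, fourier_apply_add]
    ring
  have h1 := ((character k ξ).hasDerivAt_fst p.1 p.2 0)
  simp only [e] at h1
  have h3 := h1.unique ((hasDerivAt_fourier_zero k).mul_const _)
  simp only [AddCircle.coe_zero, add_zero] at h3
  exact h3

lemma dX_character (k : ℤ) (ξ : ℝ) :
    Smooth.dX (character k ξ) = (Complex.I * ξ) • character k ξ := by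
  apply Subtype.ext
  funext p
  have h1 := ((character k ξ).hasDerivAt_snd p.1 0 p.2)
  have h2 := ((hasDerivAt_id p.2).ofReal_comp.const_mul (Complex.I * ξ)).cexp.const_mul
    (fourier k p.1)
  simp only [character_apply, zero_add] at h1
  refine (h1.unique h2).trans ?_
  change _ = (Complex.I * ξ) * (fourier k p.1 * Complex.exp (Complex.I * ξ * p.2))
  simp
  ring

/-- The region `|x| > R` is open in `x` and contains whole circles, so vanishing there passes to
both partial derivatives. -/
lemma Smooth.iterD_eq_zero_of_lt {f : Smooth} {R : ℝ}
    (hf : ∀ p : Cyl, R < |p.2| → (f : Cyl → ℂ) p = 0) (a b : ℕ) (p : Cyl) (hp : R < |p.2|) :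
    (Smooth.iterD a b f : Cyl → ℂ) p = 0 := by
  have hT (g : Smooth) (hg : ∀ p : Cyl, R < |p.2| → (g : Cyl → ℂ) p = 0) (p : Cyl)
      (hp : R < |p.2|) : (Smooth.dT g : Cyl → ℂ) p = 0 := by
    have h1 := g.hasDerivAt_fst p.1 p.2 0
    have e (s : ℝ) : (g : Cyl → ℂ) (p.1 + (s : AddCircle (2 * π)), p.2) = 0 := hg _ hp
    simp only [e] at h1
    have h3 := h1.unique (hasDerivAt_const _ _)
    simpa using h3
  have hX (g : Smooth) (hg : ∀ p : Cyl, R < |p.2| → (g : Cyl → ℂ) p = 0) (p : Cyl)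
      (hp : R < |p.2|) : (Smooth.dX g : Cyl → ℂ) p = 0 := by
    have h1 := g.hasDerivAt_snd p.1 0 p.2
    have ho : IsOpen {s : ℝ | R < |0 + s|} :=
      isOpen_lt continuous_const (continuous_const.add continuous_id).abs
    have h2 : (fun s : ℝ => (g : Cyl → ℂ) (p.1, 0 + s)) =ᶠ[nhds p.2] fun _ => 0 :=
      Filter.eventually_of_mem (ho.mem_nhds (by simpa using hp)) fun s hs => hg _ hs
    have h3 := h1.unique ((hasDerivAt_const p.2 (0 : ℂ)).congr_of_eventuallyEq h2)
    simpa using h3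
  have hXb : ∀ p : Cyl, R < |p.2| → ((Smooth.dX ^ b) f : Cyl → ℂ) p = 0 := by
    induction b with
    | zero => exact hf
    | succ b ih =>
      rw [pow_succ']
      exact hX _ ih
  have hTa : ∀ p : Cyl, R < |p.2| →
      ((Smooth.dT ^ a) ((Smooth.dX ^ b) f) : Cyl → ℂ) p = 0 := by
    induction a with
    | zero => exact hXb
    | succ a ih =>
      rw [pow_succ']
      exact hT _ ih
  exact hTa p hp

lemma Smooth.mem_schwartz_of_eq_zero {f : Smooth} {R : ℝ}
    (hf : ∀ p : Cyl, R < |p.2| → (f : Cyl → ℂ) p = 0) : f ∈ schwartzSubmodule := by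
  intro a b c
  have hK : IsCompact ((Set.univ : Set (AddCircle (2 * π))) ×ˢ Set.Icc (-R) R) :=
    isCompact_univ.prod isCompact_Icc
  have hc : Continuous (weighted a b c f) :=
    (continuous_snd.abs.pow c).mul (Smooth.iterD a b f).continuous.norm
  obtain ⟨C, hC⟩ := hK.bddAbove_image hc.continuousOn
  refine ⟨max C 0, ?_⟩
  rintro _ ⟨p, rfl⟩
  by_cases hp : R < |p.2|
  · simp [weighted, Smooth.iterD_eq_zero_of_lt hf a b p hp]
  · exact (hC ⟨p, ⟨trivial, abs_le.1 (not_lt.1 hp)⟩, rfl⟩).trans (le_max_left _ _)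

/-- The product of a character and a bump function of the variable on the line. -/
def characterBump (k : ℤ) (ξ : ℝ) {n : ℝ} (φ : ContDiffBump n) : Schwartz :=
  ⟨⟨fun p => (character k ξ : Cyl → ℂ) p * (φ p.2 : ℂ), by
      change ContDiff ℝ ∞ fun r : ℝ × ℝ => lift (character k ξ) r * Complex.ofRealCLM (φ r.2)
      exact (character k ξ).contDiff.mul
        (Complex.ofRealCLM.contDiff.comp (φ.contDiff.comp contDiff_snd))⟩,
    Smooth.mem_schwartz_of_eq_zero (R := |n| + φ.rOut) fun p hp => by
      have h : φ p.2 = 0 := φ.zero_of_le_dist (by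
        rw [Real.dist_eq]
        have := abs_sub_abs_le_abs_sub p.2 n
        linarith)
      simp [h]⟩

lemma characterBump_apply (k : ℤ) (ξ : ℝ) {n : ℝ} (φ : ContDiffBump n) (p : Cyl) :
    characterBump k ξ φ p = (character k ξ : Cyl → ℂ) p * (φ p.2 : ℂ) := rfl

/-- Far out on the line `|g| ≤ 1/2`. Testing against the inverse character times a bump placed there
gives the full mass of the bump on one side and at most half of it on the other. -/
lemma character_toTempered_ne (k : ℤ) (ξ : ℝ) (hb : ∃ C, ∀ p, ‖(character k ξ : Cyl → ℂ) p‖ ≤ C)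
    (g : Schwartz) : (character k ξ).toTempered hb ≠ g.toTempered := by
  intro he
  set M := g.seminorm 0 0 1 with hM
  have hM0 : 0 ≤ M := g.seminorm_nonneg 0 0 1
  -- With centre `2 M + 2` and outer radius `2` the bump vanishes unless `x > 2 M`, where `|x g| ≤
  -- M` gives `|g| ≤ 1/2`.
  let φ : ContDiffBump (2 * M + 2) := ⟨1, 2, one_pos, one_lt_two⟩
  have hφi : Integrable fun p : Cyl => φ p.2 :=
    φ.integrable.comp_snd (volume : Measure (AddCircle (2 * π)))
  have hφ : 0 < ∫ p : Cyl, φ p.2 := by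
    have h := integral_fun_snd (μ := (volume : Measure (AddCircle (2 * π))))
      (ν := (volume : Measure ℝ)) (fun x => φ x)
    refine lt_of_lt_of_eq ?_ h.symm
    refine mul_pos ?_ φ.integral_pos
    rw [Measure.real, AddCircle.measure_univ, ENNReal.toReal_ofReal Real.two_pi_pos.le]
    exact Real.two_pi_pos
  have e1 : ∫ p : Cyl, (character k ξ : Cyl → ℂ) p * characterBump (-k) (-ξ) φ p =
      ∫ p : Cyl, g p * characterBump (-k) (-ξ) φ p :=
    congrArg (fun u : Tempered => u.1 (characterBump (-k) (-ξ) φ)) he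
  simp only [characterBump_apply, ← mul_assoc, character_mul_neg, one_mul] at e1
  rw [integral_complex_ofReal] at e1
  have h2 : ‖∫ p : Cyl, g p * (character (-k) (-ξ) : Cyl → ℂ) p * (φ p.2 : ℂ)‖ ≤
      ∫ p : Cyl, 1 / 2 * φ p.2 := by
    refine norm_integral_le_of_norm_le (hφi.const_mul _) (Filter.Eventually.of_forall fun p => ?_)
    rw [norm_mul, norm_mul, norm_character, mul_one, Complex.norm_real,
      Real.norm_of_nonneg φ.nonneg]
    by_cases hp : dist p.2 (2 * M + 2) < 2
    · refine mul_le_mul_of_nonneg_right ?_ φ.nonneg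
      rw [Real.dist_eq, abs_lt] at hp
      have h1 := g.weighted_le 0 0 1 p
      simp only [weighted, Smooth.iterD, pow_zero, mul_one, Module.End.one_apply, pow_one] at h1
      have hx : 0 < p.2 := by linarith
      rw [abs_of_pos hx, ← hM] at h1
      by_contra! hlt
      nlinarith
    · rw [φ.zero_of_le_dist (not_lt.1 hp)]
      simp
  rw [← e1, Complex.norm_real, Real.norm_of_nonneg hφ.le, integral_const_mul] at h2
  linarith

end TorusLine

end

theorem mainTheorem3 (c₁ c₂ c₃ : ℂ) (hc : c₁ ≠ 0 ∨ c₂ ≠ 0) :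
    TorusLine.IsSchwartzGloballyHypoelliptic (TorusLine.firstOrderOp c₁ c₂ c₃) ↔
      {p : ℤ × ℝ | c₁ * (p.1 : ℂ) + c₂ * (p.2 : ℂ) - Complex.I * c₃ = 0} = ∅ := by
  open TorusLine in
  constructor
  · intro hL
    refine Set.eq_empty_iff_forall_notMem.2 ?_
    rintro ⟨k, ξ⟩ hk
    have hk' : c₁ * (k : ℂ) + c₂ * (ξ : ℂ) - Complex.I * c₃ = 0 := hk
    have hb : ∃ C, ∀ p, ‖(character k ξ : Cyl → ℂ) p‖ ≤ C := ⟨1, fun p => (norm_character k ξ p).le⟩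
    have hT (p : Cyl) : (Smooth.dT (character k ξ) : Cyl → ℂ) p =
        Complex.I * k * (character k ξ : Cyl → ℂ) p := by rw [dT_character]; rfl
    have hX (p : Cyl) : (Smooth.dX (character k ξ) : Cyl → ℂ) p =
        Complex.I * ξ * (character k ξ : Cyl → ℂ) p := by rw [dX_character]; rfl
    obtain ⟨g, hg⟩ := hL ((character k ξ).toTempered hb) ⟨0, by
      apply Subtype.ext
      refine LinearMap.ext fun f => ?_
      rw [firstOrderOp_apply]
      refine (Smooth.integral_mul_schwartzOp hb
        ⟨‖Complex.I * (k : ℂ)‖, fun p => by rw [hT, norm_mul, norm_character, mul_one]⟩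
        ⟨‖Complex.I * (ξ : ℂ)‖, fun p => by rw [hX, norm_mul, norm_character, mul_one]⟩
        c₁ c₂ c₃ f).trans ?_
      change _ = ∫ p : Cyl, (0 : ℂ) * f p
      congr 1
      funext p
      rw [hT, hX]
      -- Applied to the character, `L` multiplies it by `i` times the symbol.
      linear_combination (Complex.I * (character k ξ : Cyl → ℂ) p * f p) * hk' +
        c₃ * (character k ξ : Cyl → ℂ) p * f p * Complex.I_sq⟩
    exact character_toTempered_ne k ξ hb g hg
  · intro h u ⟨f, hf⟩
    have h1 (k : ℤ) (ξ : ℝ) : c₁ * (k : ℂ) + c₂ * (ξ : ℂ) - Complex.I * c₃ ≠ 0 := fun h0 =>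
      Set.eq_empty_iff_forall_notMem.1 h (k, ξ) h0
    -- The symbol of the transpose at `(k, ξ)` is the symbol of `L` at `(-k, -ξ)`.
    have h2 (k : ℤ) (ξ : ℝ) : -c₁ * (k : ℂ) + -c₂ * (ξ : ℂ) - Complex.I * c₃ ≠ 0 := by
      have := h1 (-k) (-ξ)
      push_cast at this
      simpa using this
    obtain ⟨g, rfl⟩ := schwartzOp_surjective hc h1 f
    refine ⟨g, Subtype.ext (LinearMap.ext fun φ => ?_)⟩
    obtain ⟨ψ, rfl⟩ := schwartzOp_surjective (by simpa using hc) h2 φ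
    rw [← firstOrderOp_apply, ← firstOrderOp_apply, hf, firstOrderOp_toTempered]
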